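/- **Definitions.** All graphs are finite and undirected. An $s$-$t$ graph is a graph with two distinct distinguished vertices $s,t$ and lengths $\mathsf{len}(e)\ge 0$ on its edges; $d_G$ is its shortest-path metric. $H\oslash G$ is obtained from $H$ by replacing every edge $e=(u,v)$ (with an arbitrary fixed orientation) by a copy of $G$, with $s(G)$ identified with $u$ and $t(G)$ with $v$, in which all lengths are multiplied by $\mathsf{len}_H(e)/d_G(s(G),t(G))$. The terminals of $H\oslash G$ are those of $H$. $G^{\oslash 0}$ is a single edge of unit length and $G^{\oslash k}=G^{\oslash (k-1)}\oslash G$. $K_{2,n}$ is the complete bipartite graph with unit lengths whose side of size two is $\{s,t\}$. The distortion of an injective map $f:(X,d)\to L_1$ is $$\sup_{x\ne y}\frac{\|f(x)-f(y)\|_1}{d(x,y)}\cdot\sup_{x\ne y}\frac{d(x,y)}{\|f(x)-f(y)\|_1},$$ and $c_1(X)$ is the infimum of the distortions of all injective maps from $X$ into spaces $L_1(\Omega,\mu)$; $c_1(G)$ means $c_1(V(G),d_G)$. A multicommodity flow instance on $G$ consists of capacities $C(e)\ge 0$ on the edges and $m\ge 1$ pairs $s_i\neq t_i$ of vertices with demands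 $D_i\ge 1$. Let $\lambda^*$ be the largest fraction of all demands that can be shipped simultaneously subject to the capacities, and let $$\Phi^*=\min_S \frac{\sum_{uv\in E}C(uv)\,|\mathbf 1_S(u)-\mathbf 1_S(v)|}{\sum_i D_i\,|\mathbf 1_S(s_i)-\mathbf 1_S(t_i)|}$$ over the cuts $S\subseteq V$ with positive denominator. The flow/cut gap of the instance is $\Phi^*/\lambda^*$ (with $0/0=0$), and the flow/cut gap of $G$ is the supremum of the gaps of all instances on $G$. **Theorem.** For every $n\ge 2$: 1. the limit $\lim_{k\to\infty}c_1(K_{2,n}^{\oslash k})$ exists in $[0,\infty]$ and is at least $2-\frac2n$; 2. for every $k\ge 0$ the graph $K_{2,n}^{\oslash k}$ is (two-terminal) series-parallel, with terminals $s,t$, and planar; 3. $\liminf_{k\to\infty}$ of the flow/cut gap of $K_{2,n}^{\oslash k}$ is at least $2-\frac2n$. Consequently, there are numbers $k_n$ and multicommodity flow instances $I_n$ on the graphs $K_{2,n}^{\oslash k_n}$ such that the flow/cut gap of $I_n$ tends to $2$ as $n\to\infty$. -/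

import Mathlib

open Filter Topology MeasureTheory
open scoped NNReal ENNReal

noncomputable section

/-- A finite `s`-`t` graph with non-negative edge lengths.  Every edge carries an (arbitrary)
orientation from `src` to `tgt`, which says how a graph is substituted for that edge; walks,
distances, cuts and flows below ignore the orientation. -/
structure STGraph where
  V : Type
  E : Type
  [fintypeV : Fintype V]
  [fintypeE : Fintype E]
  src : E → V
  tgt : E → V
  s : V
  t : V
  s_ne_t : s ≠ t
  len : E → ℝ≥0

namespace STGraph

attribute [instance] STGraph.fintypeV STGraph.fintypeE

/-- `G.IsWalk u l v`: the list of edges `l`, each traversed in either direction, is a walk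
from `u` to `v`. -/
def IsWalk (G : STGraph) (u : G.V) (l : List G.E) (v : G.V) : Prop :=
  match l with
  | [] => u = v
  | e :: l => (G.src e = u ∧ IsWalk G (G.tgt e) l v) ∨ (G.tgt e = u ∧ IsWalk G (G.src e) l v)

/-- The shortest-path distance (of a connected graph): the least total length of a walk. -/
def dist (G : STGraph) (u v : G.V) : ℝ≥0 :=
  sInf {x : ℝ≥0 | ∃ l : List G.E, G.IsWalk u l v ∧ x = (l.map G.len).sum}

/-- The vertices of `H ⊘ G`: those of `H`, and for every edge of `H` the non-terminal
vertices of `G`. -/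
abbrev CompV (H G : STGraph) : Type :=
  H.V ⊕ (H.E × {v : G.V // v ≠ G.s ∧ v ≠ G.t})

open Classical in
/-- The place in `H ⊘ G` of the vertex `v` of the copy of `G` that replaces the edge `e` of `H`:
`s(G)` and `t(G)` are identified with the two ends of `e`. -/
def copyVertex (H G : STGraph) (e : H.E) (v : G.V) : CompV H G :=
  if hs : v = G.s then Sum.inl (H.src e)
  else if ht : v = G.t then Sum.inl (H.tgt e)
  else Sum.inr (e, ⟨v, hs, ht⟩)

open Classical in
/-- The composition `H ⊘ G`: every edge of `H` is replaced by a copy of `G`, whose lengths are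
rescaled so that its terminals are at distance the length of the replaced edge. -/
def comp (H G : STGraph) : STGraph where
  V := CompV H G
  E := H.E × G.E
  src := fun a => copyVertex H G a.1 (G.src a.2)
  tgt := fun a => copyVertex H G a.1 (G.tgt a.2)
  s := Sum.inl H.s
  t := Sum.inl H.t
  s_ne_t := fun h => H.s_ne_t (Sum.inl.inj h)
  len := fun a => H.len a.1 / G.dist G.s G.t * G.len a.2

/-- A single edge of unit length. -/
def singleEdge : STGraph where
  V := Bool
  E := Unit
  src := fun _ => false
  tgt := fun _ => true
  s := false
  t := true
  s_ne_t := Bool.false_ne_true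
  len := fun _ => 1

/-- The recursive composition: the `0`-th power is a single unit edge, and the `(k+1)`-st power
is the `k`-th power composed with `G`. -/
def power (G : STGraph) : ℕ → STGraph
  | 0 => singleEdge
  | k + 1 => comp (power G k) G

/-- The complete bipartite graph `K_{2,n}` with unit lengths.  The side of size two is
`s = inl false`, `t = inl true`; the other vertices are `inr i`.  The edge `(i, false)` joins
`s` to `inr i`, and `(i, true)` joins `inr i` to `t`. -/
def K2 (n : ℕ) : STGraph where
  V := Bool ⊕ Fin n
  E := Fin n × Bool
  src := fun a => if a.2 then Sum.inr a.1 else Sum.inl false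
  tgt := fun a => if a.2 then Sum.inl true else Sum.inr a.1
  s := Sum.inl false
  t := Sum.inl true
  s_ne_t := by simp
  len := fun _ => 1

/-! ### Series-parallel and planar graphs -/

/-- The set of the end vertices of a set of edges. -/
def ends (G : STGraph) (A : Set G.E) : Set G.V := G.src '' A ∪ G.tgt '' A

/-- The subgraph formed by the edges in `A` and their ends is a two-terminal series-parallel
graph with terminals `u` and `v`. -/
inductive IsSPBetween (G : STGraph) : Set G.E → G.V → G.V → Prop
  | edge (e : G.E) {u v : G.V} (huv : u ≠ v)
      (he : (G.src e = u ∧ G.tgt e = v) ∨ (G.src e = v ∧ G.tgt e = u)) :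
      IsSPBetween G {e} u v
  | series {A B : Set G.E} {u w v : G.V} (hA : IsSPBetween G A u w) (hB : IsSPBetween G B w v)
      (hAB : G.ends A ∩ G.ends B = {w}) :
      IsSPBetween G (A ∪ B) u v
  | parallel {A B : Set G.E} {u v : G.V} (hA : IsSPBetween G A u v) (hB : IsSPBetween G B u v)
      (hdisj : Disjoint A B) (hAB : G.ends A ∩ G.ends B = {u, v}) :
      IsSPBetween G (A ∪ B) u v

/-- The whole `s`-`t` graph is two-terminal series-parallel, with its own terminals. -/
def IsSeriesParallel (G : STGraph) : Prop :=
  G.IsSPBetween Set.univ G.s G.t ∧ G.ends Set.univ = Set.univ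

/-- The graph can be drawn in the plane: vertices are distinct points, and edges are curves
joining their ends, whose interiors are simple, pairwise disjoint and avoid all vertices. -/
def IsPlanar (G : STGraph) : Prop :=
  ∃ (p : G.V → ℝ × ℝ) (γ : G.E → ℝ → ℝ × ℝ),
    Function.Injective p ∧
    (∀ e, ContinuousOn (γ e) (Set.Icc 0 1) ∧ γ e 0 = p (G.src e) ∧ γ e 1 = p (G.tgt e)) ∧
    (∀ e, ∀ x ∈ Set.Ioo (0 : ℝ) 1, ∀ v, γ e x ≠ p v) ∧
    (∀ e e', ∀ x ∈ Set.Ioo (0 : ℝ) 1, ∀ x' ∈ Set.Ioo (0 : ℝ) 1,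
      γ e x = γ e' x' → e = e' ∧ x = x')

/-! ### Multicommodity flows and cuts -/

/-- A multicommodity flow instance on `G`: capacities on the edges, and finitely many
(at least one) terminal pairs with demands. -/
structure FlowInstance (G : STGraph) where
  cap : G.E → ℝ≥0
  m : ℕ
  m_pos : 0 < m
  source : Fin m → G.V
  target : Fin m → G.V
  source_ne_target : ∀ i, source i ≠ target i
  demand : Fin m → ℝ
  one_le_demand : ∀ i, 1 ≤ demand i

namespace FlowInstance

variable {G : STGraph}

open Classical in
/-- `f i e` is the signed amount of commodity `i` sent along `e` (positive from `src e` to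
`tgt e`).  The flow ships the fraction `r` of every demand simultaneously, and all commodities
together respect the capacities. -/
def IsConcurrentFlow (I : FlowInstance G) (r : ℝ) (f : Fin I.m → G.E → ℝ) : Prop :=
  (∀ i v, (∑ e, if G.src e = v then f i e else 0) - (∑ e, if G.tgt e = v then f i e else 0) =
    r * I.demand i * ((if v = I.source i then 1 else 0) - (if v = I.target i then 1 else 0))) ∧
  (∀ e, ∑ i, |f i e| ≤ I.cap e)

/-- The largest fraction of all the demands that can be shipped simultaneously. -/
def maxFlow (I : FlowInstance G) : ℝ≥0∞ :=
  ⨆ (r : ℝ) (_ : 0 ≤ r ∧ ∃ f, I.IsConcurrentFlow r f), ENNReal.ofReal r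

/-- The cut semi-metric `|1_S(u) - 1_S(v)|`. -/
def cutDist (S : Set G.V) (u v : G.V) : ℝ :=
  |S.indicator (fun _ => (1 : ℝ)) u - S.indicator (fun _ => (1 : ℝ)) v|

/-- The total capacity that crosses the cut `S`. -/
def cutCap (I : FlowInstance G) (S : Set G.V) : ℝ :=
  ∑ e, (I.cap e : ℝ) * cutDist S (G.src e) (G.tgt e)

/-- The total demand that crosses the cut `S`. -/
def cutDemand (I : FlowInstance G) (S : Set G.V) : ℝ :=
  ∑ i, I.demand i * cutDist S (I.source i) (I.target i)

/-- The sparsest cut ratio: the minimum of capacity over demand, among the cuts that separate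
some terminal pair. -/
def sparsestCut (I : FlowInstance G) : ℝ≥0∞ :=
  ⨅ (S : Set G.V) (_ : 0 < I.cutDemand S), ENNReal.ofReal (I.cutCap S / I.cutDemand S)

/-- The flow/cut gap of an instance. -/
def gap (I : FlowInstance G) : ℝ≥0∞ := I.sparsestCut / I.maxFlow

end FlowInstance

/-- The flow/cut gap of a graph: the worst gap over all capacities and demands. -/
def flowCutGap (G : STGraph) : ℝ≥0∞ := ⨆ I : FlowInstance G, I.gap

end STGraph

/-! ### Distortion of embeddings into `L₁` -/

/-- The distortion `‖f‖_Lip * ‖f⁻¹‖_Lip` of an injective map from the metric `d`. -/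
def distortion {X Y : Type*} [EDist Y] (d : X → X → ℝ≥0) (f : X → Y) : ℝ≥0∞ :=
  (⨆ (x : X) (y : X) (_ : x ≠ y), edist (f x) (f y) / (d x y : ℝ≥0∞)) *
    (⨆ (x : X) (y : X) (_ : x ≠ y), (d x y : ℝ≥0∞) / edist (f x) (f y))

/-- The least distortion of an embedding of the metric `d` into a space `L₁(Ω, μ)`. -/
def c1 {X : Type*} (d : X → X → ℝ≥0) : ℝ≥0∞ :=
  ⨅ (Ω : Type) (_ : MeasurableSpace Ω) (μ : Measure Ω) (f : X → Lp ℝ 1 μ)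
    (_ : Function.Injective f), distortion d f

end

/-!
Write `G k` for the `k`-th power of `K_{2,n}`. The lower bounds rest on one explicit family of
demands on `G k` (`STGraph.demands`): for each scale `j < k` and each copy of `K_{2,n}` that
replaces an edge of `G j`, all pairs of middle vertices of the copy, so weighted that every scale
contributes equally to the sum of demand times distance.

For an `L₁` metric `ρ`, the middle vertices `y i` of a copy with terminals `a`, `b` satisfy
`∑ i, ∑ j, ρ (y i) (y j) ≤ (n ^ 2 / 2) ρ a b + n ∑ i, (ρ a (y i) + ρ (y i) b - ρ a b)`
(`sum_abs_sub_add_le` on the line, `isK2Semimetric_L1` in general): if the two-edge paths are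
geodesics of `ρ`, the middle vertices lie between `a` and `b`, so their mean mutual distance is at
most about half of `ρ a b`, whereas it equals the distance of `a` and `b` in the graph. The second
term is the amount by which the total `ρ`-length of the edges grows when edges are replaced by
copies of `K_{2,n}`. Summed over all scales, these terms telescope, and
`∑ demand * ρ ≤ (n k / 2 + n) ∑ ρ (edges)` follows (`STGraph.total_demands_le`). For the graph
metric the left side is `k (n - 1)` times the total length of the edges
(`STGraph.exists_edgeLipschitz_demands`). Hence
`k (n - 1) / (n k / 2 + n)`, which tends to `2 - 2 / n`, bounds from below the distortion of every
embedding into `L₁` (`STGraph.le_c1_power`) and, with `ρ` a cut semimetric and by weak duality, the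
flow/cut gap of the instance with unit capacities (`STGraph.exists_gap_bounds`). The limit of `c1`
exists since `G k` sits isometrically in `G (k + 1)` (`STGraph.dist_old`).

The gap of the same instance is at most `2`: the demands can be shipped with equal load on all
edges (`STGraph.hasFlow_demands`), and a cut that halves the middle vertices of every copy it
crosses is sparse (`STGraph.exists_sparse_cut`). With `k = n` the two bounds squeeze the gap to `2`.

Series composition, parallel composition and planarity are preserved when edges are replaced by
copies of `K_{2,n}`. Planarity uses drawings with straight edges and integer coordinates, in which
the first coordinate grows by one along every edge, so that only edges over the same unit interval
have to be compared.
-/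

namespace STGraph

/-! ### Substituting `K_{2,n}` for every edge -/

variable {H : STGraph} {n : ℕ}

/-- A vertex of `H`, as a vertex of `H ⊘ K_{2,n}`. -/
def old (n : ℕ) (v : H.V) : (comp H (K2 n)).V := Sum.inl v

/-- The `i`-th middle vertex of the copy of `K_{2,n}` that replaces the edge `e`. -/
def mid (e : H.E) (i : Fin n) : (comp H (K2 n)).V :=
  Sum.inr (e, ⟨Sum.inr i, by simp [K2]⟩)

/-- The edge of `H ⊘ K_{2,n}` that joins the `i`-th middle vertex over `e` to the source of `e`
(for `b = false`) or to its target (for `b = true`). -/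
def half (e : H.E) (i : Fin n) (b : Bool) : (comp H (K2 n)).E := (e, (i, b))

lemma src_half_false (e : H.E) (i : Fin n) :
    (comp H (K2 n)).src (half e i false) = old n (H.src e) := by
  simp [comp, half, copyVertex, K2, old]

lemma tgt_half_false (e : H.E) (i : Fin n) :
    (comp H (K2 n)).tgt (half e i false) = mid e i := by
  simp [comp, half, copyVertex, K2, mid]

lemma src_half_true (e : H.E) (i : Fin n) :
    (comp H (K2 n)).src (half e i true) = mid e i := by
  simp [comp, half, copyVertex, K2, mid]

lemma tgt_half_true (e : H.E) (i : Fin n) :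
    (comp H (K2 n)).tgt (half e i true) = old n (H.tgt e) := by
  simp [comp, half, copyVertex, K2, old]

lemma vertex_cases {P : (comp H (K2 n)).V → Prop} (h1 : ∀ v, P (old n v))
    (h2 : ∀ e i, P (mid e i)) (v) : P v := by
  rcases v with v | ⟨e, ⟨w, hw⟩⟩
  · exact h1 v
  · rcases w with w | i
    · exfalso
      cases w <;> simp [K2] at hw
    · exact h2 e i

lemma edge_cases {P : (comp H (K2 n)).E → Prop} (h : ∀ e i b, P (half e i b)) (a) : P a :=
  h a.1 a.2.1 a.2.2

lemma old_inj {u v : H.V} : old n u = old n v ↔ u = v := Sum.inl_injective.eq_iff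

lemma mid_inj {e e' : H.E} {i i' : Fin n} : mid e i = mid e' i' ↔ e = e' ∧ i = i' := by
  constructor
  · intro h
    have h2 := Sum.inr_injective h
    simp only [Prod.mk.injEq] at h2
    exact ⟨h2.1, Sum.inr_injective (congrArg Subtype.val h2.2)⟩
  · rintro ⟨rfl, rfl⟩; rfl

lemma old_ne_mid (v : H.V) (e : H.E) (i : Fin n) : old n v ≠ mid e i := Sum.inl_ne_inr

lemma mid_ne_old (v : H.V) (e : H.E) (i : Fin n) : mid e i ≠ old n v := Sum.inr_ne_inl

lemma half_inj {e e' : H.E} {i i' : Fin n} {b b' : Bool} :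
    half e i b = half e' i' b' ↔ e = e' ∧ i = i' ∧ b = b' := by
  refine ⟨fun h => ?_, ?_⟩
  · have h1 := congrArg Prod.fst h
    have h2 := congrArg Prod.snd h
    exact ⟨h1, congrArg Prod.fst h2, congrArg Prod.snd h2⟩
  · rintro ⟨rfl, rfl, rfl⟩; rfl

lemma sum_comp_edges {M : Type*} [AddCommMonoid M] (F : (comp H (K2 n)).E → M) :
    ∑ a, F a = ∑ e, ∑ i, (F (half e i false) + F (half e i true)) := by
  refine (Fintype.sum_prod_type (α₁ := H.E) (α₂ := Fin n × Bool) F).trans ?_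
  refine Finset.sum_congr rfl fun e _ => ?_
  refine (Fintype.sum_prod_type (α₁ := Fin n) (α₂ := Bool) fun a => F (e, a)).trans ?_
  refine Finset.sum_congr rfl fun i _ => ?_
  rw [Fintype.sum_bool, add_comm]
  rfl

/-- The function on `H ⊘ K_{2,n}` with prescribed values on the vertices of `H` and on the middle
vertices. -/
def extend {α : Type*} (g : H.V → α) (m : H.E → Fin n → α) : (comp H (K2 n)).V → α
  | Sum.inl v => g v
  | Sum.inr (_, ⟨Sum.inl b, hb⟩) => absurd hb (by cases b <;> simp [K2])
  | Sum.inr (e, ⟨Sum.inr i, _⟩) => m e i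

@[simp] lemma extend_old {α : Type*} (g : H.V → α) (m : H.E → Fin n → α) (v : H.V) :
    extend g m (old n v) = g v := rfl

@[simp] lemma extend_mid {α : Type*} (g : H.V → α) (m : H.E → Fin n → α) (e : H.E) (i : Fin n) :
    extend g m (mid e i) = m e i := rfl

/-! ### Walks, Lipschitz functions and the metric -/

section Metric

variable {G : STGraph}

lemma IsWalk.append {u v w : G.V} {l l' : List G.E} (h : G.IsWalk u l v) (h' : G.IsWalk v l' w) :
    G.IsWalk u (l ++ l') w := by
  induction l generalizing u with
  | nil => obtain rfl : u = v := h; exact h'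
  | cons e l ih =>
    rcases h with ⟨h1, h2⟩ | ⟨h1, h2⟩
    · exact Or.inl ⟨h1, ih h2⟩
    · exact Or.inr ⟨h1, ih h2⟩

lemma isWalk_edge (e : G.E) : G.IsWalk (G.src e) [e] (G.tgt e) := Or.inl ⟨rfl, rfl⟩

lemma isWalk_edge_rev (e : G.E) : G.IsWalk (G.tgt e) [e] (G.src e) := Or.inr ⟨rfl, rfl⟩

lemma IsWalk.reverse {u v : G.V} {l : List G.E} (h : G.IsWalk u l v) :
    G.IsWalk v l.reverse u := by
  induction l generalizing u with
  | nil => exact Eq.symm h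
  | cons e l ih =>
    rw [List.reverse_cons]
    rcases h with ⟨rfl, h2⟩ | ⟨rfl, h2⟩
    · exact (ih h2).append (isWalk_edge_rev e)
    · exact (ih h2).append (isWalk_edge e)

/-- Every two vertices are joined by a walk. -/
def IsConn (G : STGraph) : Prop := ∀ u v : G.V, ∃ l, G.IsWalk u l v

/-- A real function on the vertices that changes along every edge by at most its length. -/
def EdgeLipschitz (G : STGraph) (g : G.V → ℝ) : Prop :=
  ∀ e, |g (G.src e) - g (G.tgt e)| ≤ G.len e

lemma EdgeLipschitz.le_of_isWalk {g : G.V → ℝ} (hg : G.EdgeLipschitz g) {u v : G.V} {l : List G.E}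
    (h : G.IsWalk u l v) : |g u - g v| ≤ ((l.map G.len).sum : ℝ≥0) := by
  induction l generalizing u with
  | nil => obtain rfl : u = v := h; simp
  | cons e l ih =>
    have he := hg e
    rw [List.map_cons, List.sum_cons, NNReal.coe_add]
    rcases h with ⟨rfl, h2⟩ | ⟨rfl, h2⟩
    · exact (abs_sub_le _ (g (G.tgt e)) _).trans (add_le_add he (ih h2))
    · rw [abs_sub_comm] at he
      exact (abs_sub_le _ (g (G.src e)) _).trans (add_le_add he (ih h2))

lemma EdgeLipschitz.le_dist (hG : G.IsConn) {g : G.V → ℝ} (hg : G.EdgeLipschitz g) (u v : G.V) :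
    |g u - g v| ≤ G.dist u v := by
  obtain ⟨l, hl⟩ := hG u v
  have : Real.toNNReal |g u - g v| ≤ G.dist u v := by
    refine le_csInf ⟨_, l, hl, rfl⟩ ?_
    rintro x ⟨l', hl', rfl⟩
    exact Real.toNNReal_le_iff_le_coe.2 (hg.le_of_isWalk hl')
  exact Real.toNNReal_le_iff_le_coe.1 this

lemma dist_le_of_isWalk {u v : G.V} {l : List G.E} (h : G.IsWalk u l v) :
    G.dist u v ≤ (l.map G.len).sum := csInf_le' ⟨l, h, rfl⟩

lemma dist_src_tgt_le (e : G.E) : G.dist (G.src e) (G.tgt e) ≤ G.len e := by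
  simpa using dist_le_of_isWalk (isWalk_edge e)

lemma dist_self (u : G.V) : G.dist u u = 0 := by
  have : G.IsWalk u [] u := rfl
  simpa using dist_le_of_isWalk this

lemma dist_append_le (hG : G.IsConn) {u v w : G.V} {l' : List G.E} (h' : G.IsWalk v l' w) :
    G.dist u w ≤ G.dist u v + (l'.map G.len).sum := by
  obtain ⟨l, hl⟩ := hG u v
  rw [← tsub_le_iff_right]
  refine le_csInf ⟨_, l, hl, rfl⟩ ?_
  rintro x ⟨l, hl, rfl⟩
  rw [tsub_le_iff_right, ← List.sum_append, ← List.map_append]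
  exact dist_le_of_isWalk (hl.append h')

/-- The distance to a fixed vertex is Lipschitz along the edges. -/
lemma edgeLipschitz_dist (hG : G.IsConn) (u : G.V) :
    G.EdgeLipschitz fun v => (G.dist u v : ℝ) := by
  intro e
  have h1 := dist_append_le hG (u := u) (isWalk_edge e)
  have h2 := dist_append_le hG (u := u) (isWalk_edge_rev e)
  simp only [List.map_cons, List.map_nil, List.sum_cons, List.sum_nil, add_zero] at h1 h2
  have h1' : (G.dist u (G.tgt e) : ℝ) ≤ G.dist u (G.src e) + G.len e := by exact_mod_cast h1
  have h2' : (G.dist u (G.src e) : ℝ) ≤ G.dist u (G.tgt e) + G.len e := by exact_mod_cast h2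
  rw [abs_le]
  constructor <;> linarith

end Metric

lemma dist_K2 (hn : 0 < n) : (K2 n).dist (K2 n).s (K2 n).t = 2 := by
  have hw : (K2 n).IsWalk (K2 n).s [((⟨0, hn⟩ : Fin n), false), ((⟨0, hn⟩ : Fin n), true)]
      (K2 n).t := Or.inl ⟨rfl, Or.inl ⟨rfl, rfl⟩⟩
  apply le_antisymm
  · refine (dist_le_of_isWalk hw).trans ?_
    simp [K2]; norm_num
  · refine le_csInf ⟨_, _, hw, rfl⟩ ?_
    rintro x ⟨l, hl, rfl⟩
    -- the height function `0, 1, 2` on `s`, the middle vertices and `t`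
    have hg : (K2 n).EdgeLipschitz
        (Sum.elim (fun b : Bool => if b then (2 : ℝ) else 0) fun _ => 1) := by
      rintro ⟨i, b⟩
      cases b <;> simp [K2]; norm_num
    have := hg.le_of_isWalk hl
    simp only [K2, Sum.elim_inl] at this
    norm_num at this
    exact_mod_cast this

lemma len_half (hn : 0 < n) (e : H.E) (i : Fin n) (b : Bool) :
    (comp H (K2 n)).len (half e i b) = H.len e / 2 := by
  change H.len e / (K2 n).dist (K2 n).s (K2 n).t * 1 = _
  rw [dist_K2 hn, mul_one]

lemma exists_lift_isWalk (hn : 0 < n) {u v : H.V} {l : List H.E} (h : H.IsWalk u l v) :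
    ∃ l', (comp H (K2 n)).IsWalk (old n u) l' (old n v) ∧
      (l'.map (comp H (K2 n)).len).sum = (l.map H.len).sum := by
  induction l generalizing u with
  | nil => obtain rfl : u = v := h; exact ⟨[], rfl, rfl⟩
  | cons e l ih =>
    have h1 := isWalk_edge (half e (⟨0, hn⟩ : Fin n) false)
    have h2 := isWalk_edge (half e (⟨0, hn⟩ : Fin n) true)
    have h3 := isWalk_edge_rev (half e (⟨0, hn⟩ : Fin n) false)
    have h4 := isWalk_edge_rev (half e (⟨0, hn⟩ : Fin n) true)
    rw [src_half_false, tgt_half_false] at h1 h3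
    rw [src_half_true, tgt_half_true] at h2 h4
    rcases h with ⟨rfl, h⟩ | ⟨rfl, h⟩
    · obtain ⟨l', hl', hs⟩ := ih h
      refine ⟨_, (h1.append h2).append hl', ?_⟩
      simp only [List.map_append, List.sum_append, hs, List.map_cons, List.map_nil, List.sum_cons,
        List.sum_nil, len_half hn, add_zero, add_halves]
    · obtain ⟨l', hl', hs⟩ := ih h
      refine ⟨_, (h4.append h3).append hl', ?_⟩
      simp only [List.map_append, List.sum_append, hs, List.map_cons, List.map_nil, List.sum_cons,
        List.sum_nil, len_half hn, add_zero, add_halves]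

lemma IsConn.comp (hn : 0 < n) (hH : H.IsConn) : (comp H (K2 n)).IsConn := by
  have key : ∀ v : (STGraph.comp H (K2 n)).V, ∃ w l,
      (STGraph.comp H (K2 n)).IsWalk v l (old n w) := by
    refine vertex_cases (fun v => ⟨v, [], rfl⟩) fun e i => ?_
    have h3 := isWalk_edge_rev (half e i false)
    rw [src_half_false, tgt_half_false] at h3
    exact ⟨_, _, h3⟩
  intro u v
  obtain ⟨u', l, hl⟩ := key u
  obtain ⟨v', l', hl'⟩ := key v
  obtain ⟨m, hm⟩ := hH u' v'
  obtain ⟨m', hm', -⟩ := exists_lift_isWalk hn hm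
  exact ⟨_, (hl.append hm').append hl'.reverse⟩

/-- Averaging the two ends of an edge extends a Lipschitz function to the middle vertices. -/
lemma EdgeLipschitz.extend (hn : 0 < n) {g : H.V → ℝ} (hg : H.EdgeLipschitz g) :
    (comp H (K2 n)).EdgeLipschitz
      (extend g fun e _ => (g (H.src e) + g (H.tgt e)) / 2) := by
  refine edge_cases fun e i b => ?_
  have h := hg e
  rw [abs_le] at h
  cases b
  · rw [src_half_false, tgt_half_false, extend_old, extend_mid, len_half hn, abs_le]
    push_cast
    constructor <;> linarith
  · rw [src_half_true, tgt_half_true, extend_old, extend_mid, len_half hn, abs_le]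
    push_cast
    constructor <;> linarith

/-- `H` sits isometrically in `H ⊘ K_{2,n}`. -/
lemma dist_old (hn : 0 < n) (hH : H.IsConn) (u v : H.V) :
    (comp H (K2 n)).dist (old n u) (old n v) = H.dist u v := by
  apply le_antisymm
  · obtain ⟨l, hl⟩ := hH u v
    refine le_csInf ⟨_, l, hl, rfl⟩ ?_
    rintro x ⟨l', hl', rfl⟩
    obtain ⟨m, hm, hs⟩ := exists_lift_isWalk hn hl'
    exact hs ▸ dist_le_of_isWalk hm
  · have := ((edgeLipschitz_dist hH u).extend hn).le_dist (hH.comp hn) (old n u) (old n v)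
    simp only [extend_old, dist_self, NNReal.coe_zero, zero_sub, abs_neg, NNReal.abs_eq] at this
    exact_mod_cast this

lemma isConn_power (hn : 0 < n) (k : ℕ) : ((K2 n).power k).IsConn := by
  induction k with
  | zero =>
    have h1 : singleEdge.IsWalk false [()] true := isWalk_edge (G := singleEdge) ()
    intro u v
    cases u <;> cases v
    · exact ⟨[], rfl⟩
    · exact ⟨_, h1⟩
    · exact ⟨_, h1.reverse⟩
    · exact ⟨[], rfl⟩
  | succ k ih => exact ih.comp hn

lemma len_power (hn : 0 < n) (k : ℕ) (e : ((K2 n).power k).E) :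
    ((K2 n).power k).len e = 1 / 2 ^ k := by
  induction k with
  | zero => simp [power, singleEdge]
  | succ k ih =>
    revert e
    change ∀ e : (comp ((K2 n).power k) (K2 n)).E, (comp ((K2 n).power k) (K2 n)).len e = _
    refine edge_cases fun e i b => ?_
    rw [len_half hn, ih e, pow_succ]
    field_simp

lemma card_edges_power (n k : ℕ) :
    (∑ _e : ((K2 n).power k).E, (1 : ℝ)) = (2 * n) ^ k := by
  induction k with
  | zero => exact (Fintype.sum_unique (ι := Unit) _).trans (pow_zero _).symm
  | succ k ih =>
    have h := sum_comp_edges (H := (K2 n).power k) (n := n) fun _ => (1 : ℝ)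
    refine h.trans ?_
    have : ∀ e : ((K2 n).power k).E, ∑ _i : Fin n, ((1 : ℝ) + 1) = 1 * (2 * n) := by
      intro e; simp; ring
    rw [Finset.sum_congr rfl fun e _ => this e, ← Finset.sum_mul, ih, pow_succ]

end STGraph

/-! ### An inequality for `L₁` metrics on a copy of `K_{2,n}` -/

/-- For a point `y` and an interval with ends `a`, `b`, the number `|a - y| - |y - b|` is twice the
coordinate, measured from the midpoint, of the projection of `y` to the interval, and
`|a - y| + |y - b| - |a - b|` is twice the distance of `y` to the interval. -/
lemma abs_sub_le_of_projection (a b x y : ℝ) :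
    |x - y| ≤ |(|a - x| - |x - b|) - (|a - y| - |y - b|)| / 2 +
      ((|a - x| + |x - b| - |a - b|) + (|a - y| + |y - b| - |a - b|)) / 2 := by
  rcases abs_cases (a - x) with h1 | h1 <;> rcases abs_cases (x - b) with h2 | h2 <;>
  rcases abs_cases (a - y) with h3 | h3 <;> rcases abs_cases (y - b) with h4 | h4 <;>
  rw [h1.1, h2.1, h3.1, h4.1] <;>
  rcases abs_cases (a - b) with h5 | h5 <;> rw [h5.1, abs_le] <;> constructor <;>
  cases abs_cases (a - x - (x - b) - (a - y - (y - b))) <;>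
  grind

/-- The sum of the mutual distances of `n` points of an interval of length `2L`. -/
lemma sum_abs_sub_le {n : ℕ} {L : ℝ} (w : Fin n → ℝ) (hw : ∀ i, |w i| ≤ L) :
    ∑ i, ∑ j, |w i - w j| ≤ n ^ 2 * L := by
  rcases n.eq_zero_or_pos with rfl | hn
  · simp
  rcases ((abs_nonneg _).trans (hw ⟨0, hn⟩)).eq_or_lt with rfl | hL
  · have : ∀ i, w i = 0 := fun i => abs_nonpos_iff.1 (hw i)
    simp [this]
  have hpt : ∀ i j, L * |w i - w j| ≤ L ^ 2 - w i * w j := by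
    intro i j
    have hi := abs_le.1 (hw i)
    have hj := abs_le.1 (hw j)
    rcases abs_cases (w i - w j) with h | h <;> rw [h.1]
    · nlinarith [mul_nonneg (sub_nonneg.2 hi.2) (neg_le_iff_add_nonneg.1 hj.1)]
    · nlinarith [mul_nonneg (sub_nonneg.2 hj.2) (neg_le_iff_add_nonneg.1 hi.1)]
  have hsum : L * ∑ i, ∑ j, |w i - w j| ≤ L * (n ^ 2 * L) := by
    calc L * ∑ i, ∑ j, |w i - w j| = ∑ i, ∑ j, L * |w i - w j| := by
          simp only [Finset.mul_sum]
      _ ≤ ∑ i, ∑ j, (L ^ 2 - w i * w j) :=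
          Finset.sum_le_sum fun i _ => Finset.sum_le_sum fun j _ => hpt i j
      _ = n ^ 2 * L ^ 2 - (∑ i, w i) ^ 2 := by
          simp only [Finset.sum_sub_distrib, ← Finset.mul_sum, ← Finset.sum_mul, Finset.sum_const,
            Finset.card_univ, Fintype.card_fin, nsmul_eq_mul]
          ring
      _ ≤ L * (n ^ 2 * L) := by nlinarith [sq_nonneg (∑ i, w i)]
  exact le_of_mul_le_mul_left hsum hL

lemma sum_abs_sub_add_le {n : ℕ} (a b : ℝ) (y : Fin n → ℝ) :
    ∑ i, ∑ j, |y i - y j| + n ^ 2 / 2 * |a - b| ≤ n * ∑ i, (|a - y i| + |y i - b|) := by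
  have h1 : ∑ i, ∑ j, |y i - y j| ≤ ∑ i, ∑ j,
      (|(|a - y i| - |y i - b|) - (|a - y j| - |y j - b|)| / 2 +
      ((|a - y i| + |y i - b| - |a - b|) + (|a - y j| + |y j - b| - |a - b|)) / 2) :=
    Finset.sum_le_sum fun i _ => Finset.sum_le_sum fun j _ => abs_sub_le_of_projection ..
  have h2 : ∑ i, ∑ j, |(|a - y i| - |y i - b|) - (|a - y j| - |y j - b|)| ≤ n ^ 2 * |a - b| := by
    refine sum_abs_sub_le (fun i => |a - y i| - |y i - b|) fun i => ?_
    have := abs_abs_sub_abs_le_abs_sub (a - y i) (-(y i - b))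
    rw [abs_neg] at this
    exact this.trans_eq (by ring_nf)
  simp only [Finset.sum_add_distrib, ← Finset.sum_div, Finset.sum_sub_distrib, Finset.sum_const,
    Finset.card_univ, Fintype.card_fin, nsmul_eq_mul, ← Finset.mul_sum] at h1 h2 ⊢
  linarith

/-- A semimetric that satisfies the Poincaré-type inequality of `L₁` for all copies of `K_{2,n}`
with terminals `a`, `b` and middle vertices `y i`. -/
structure IsK2Semimetric {X : Type*} (n : ℕ) (ρ : X → X → ℝ) : Prop where
  self (x : X) : ρ x x = 0
  nonneg (x y : X) : 0 ≤ ρ x y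
  triangle (x y z : X) : ρ x z ≤ ρ x y + ρ y z
  sum_le (a b : X) (y : Fin n → X) :
    ∑ i, ∑ j, ρ (y i) (y j) + n ^ 2 / 2 * ρ a b ≤ n * ∑ i, (ρ a (y i) + ρ (y i) b)

lemma IsK2Semimetric.comap {X Y : Type*} {n : ℕ} {ρ : X → X → ℝ} (h : IsK2Semimetric n ρ)
    (f : Y → X) : IsK2Semimetric n fun x y => ρ (f x) (f y) :=
  ⟨fun _ => h.self _, fun _ _ => h.nonneg _ _, fun _ _ _ => h.triangle _ _ _,
    fun a b y => h.sum_le (f a) (f b) fun i => f (y i)⟩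

lemma isK2Semimetric_abs (n : ℕ) : IsK2Semimetric n fun x y : ℝ => |x - y| :=
  ⟨by simp, fun _ _ => abs_nonneg _, fun _ _ _ => abs_sub_le _ _ _, sum_abs_sub_add_le⟩

lemma isK2Semimetric_L1 (n : ℕ) {Ω : Type*} [MeasurableSpace Ω] (μ : Measure Ω) :
    IsK2Semimetric n fun x y : Lp ℝ 1 μ => ‖x - y‖ := by
  have hnorm : ∀ x y : Lp ℝ 1 μ, ‖x - y‖ = ∫ ω, |x ω - y ω| ∂μ := by
    intro x y
    rw [L1.norm_eq_integral_norm]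
    refine integral_congr_ae ?_
    filter_upwards [Lp.coeFn_sub x y] with ω hω
    rw [hω, Pi.sub_apply, Real.norm_eq_abs]
  have hint : ∀ x y : Lp ℝ 1 μ, Integrable (fun ω => |x ω - y ω|) μ := fun x y =>
    ((L1.integrable_coeFn x).sub (L1.integrable_coeFn y)).abs
  refine ⟨by simp, fun _ _ => norm_nonneg _, fun x y z => norm_sub_le_norm_sub_add_norm_sub x y z,
    fun a b y => ?_⟩
  have key : ∫ ω, (∑ i, ∑ j, |y i ω - y j ω| + n ^ 2 / 2 * |a ω - b ω|) ∂μ ≤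
      ∫ ω, (n * ∑ i, (|a ω - y i ω| + |y i ω - b ω|)) ∂μ := by
    refine integral_mono ?_ ?_ fun ω => sum_abs_sub_add_le (a ω) (b ω) fun i => y i ω
    · exact (integrable_finsetSum _ fun i _ => integrable_finsetSum _ fun j _ => hint _ _).add
        ((hint _ _).const_mul _)
    · exact (integrable_finsetSum _ fun i _ => (hint _ _).add (hint _ _)).const_mul _
  rw [integral_add (integrable_finsetSum _ fun i _ => integrable_finsetSum _ fun j _ => hint _ _)
    ((hint _ _).const_mul _), integral_const_mul, integral_const_mul,
    integral_finsetSum _ fun i _ => integrable_finsetSum _ fun j _ => hint _ _,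
    integral_finsetSum] at key
  · simp_rw [integral_add (hint _ _) (hint _ _), integral_finsetSum _ fun j _ => hint _ _,
      ← hnorm] at key
    exact key
  · exact fun i _ => (hint _ _).add (hint _ _)

namespace STGraph

variable {H : STGraph} {n : ℕ}

/-! ### The demands -/

/-- A finite family of pairs of vertices with demands. -/
structure DemandFamily (G : STGraph) where
  ι : Type
  [fintype : Fintype ι]
  source : ι → G.V
  target : ι → G.V
  demand : ι → ℝ

attribute [instance] DemandFamily.fintype

/-- The total demand, weighted with the semimetric `ρ`. -/
def DemandFamily.total {G : STGraph} (D : DemandFamily G) (ρ : G.V → G.V → ℝ) : ℝ :=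
  ∑ c, D.demand c * ρ (D.source c) (D.target c)

/-- The total length of the edges, measured with the semimetric `ρ`. -/
def edgeTotal (G : STGraph) (ρ : G.V → G.V → ℝ) : ℝ := ∑ e, ρ (G.src e) (G.tgt e)

/-- A demand family on `H` gives one on `H ⊘ K_{2,n}`: the old demands are multiplied by `n`, and
every ordered pair of distinct middle vertices of every copy of `K_{2,n}` gets a unit demand. -/
def DemandFamily.refine (D : DemandFamily H) (n : ℕ) : DemandFamily (comp H (K2 n)) where
  ι := D.ι ⊕ (H.E × {p : Fin n × Fin n // p.1 ≠ p.2})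
  source := Sum.elim (fun c => old n (D.source c)) fun q => mid q.1 q.2.1.1
  target := Sum.elim (fun c => old n (D.target c)) fun q => mid q.1 q.2.1.2
  demand := Sum.elim (fun c => n * D.demand c) fun _ => 1

/-- The demands on the `k`-th power of `K_{2,n}`: the pairs of middle vertices of the copies of
`K_{2,n}` on all scales, so weighted that all scales contribute equally. -/
noncomputable def demands (n : ℕ) : ∀ k, DemandFamily ((K2 n).power k)
  | 0 => ⟨Empty, Empty.elim, Empty.elim, Empty.elim⟩
  | k + 1 => (demands n k).refine n

lemma sum_ne_pairs (F : Fin n → Fin n → ℝ) :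
    ∑ p : {p : Fin n × Fin n // p.1 ≠ p.2}, F p.1.1 p.1.2 =
      ∑ i, ∑ j, if i ≠ j then F i j else 0 := by
  rw [← Fintype.sum_prod_type' (f := fun i j => if i ≠ j then F i j else 0),
    ← Finset.sum_filter]
  exact (Finset.sum_subtype (Finset.univ.filter fun p : Fin n × Fin n => p.1 ≠ p.2)
    (by simp) fun p => F p.1 p.2).symm

lemma sum_refine (D : DemandFamily H) (F : (D.refine n).ι → ℝ) :
    ∑ c, F c = ∑ c, F (Sum.inl c) + ∑ e, ∑ p, F (Sum.inr (e, p)) := by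
  refine (Fintype.sum_sum_type F).trans ?_
  rw [Fintype.sum_prod_type]

lemma total_refine (D : DemandFamily H) {ρ : (comp H (K2 n)).V → (comp H (K2 n)).V → ℝ}
    (hρ : ∀ x, ρ x x = 0) :
    (D.refine n).total ρ = n * D.total (fun u v => ρ (old n u) (old n v)) +
      ∑ e, ∑ i, ∑ j, ρ (mid e i) (mid e j) := by
  rw [DemandFamily.total, sum_refine, DemandFamily.total, Finset.mul_sum]
  congr 1
  · exact Finset.sum_congr rfl fun c _ => mul_assoc _ _ _
  · refine Finset.sum_congr rfl fun e _ => ?_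
    refine (sum_ne_pairs fun i j => 1 * ρ (mid e i) (mid e j)).trans ?_
    refine Finset.sum_congr rfl fun i _ => Finset.sum_congr rfl fun j _ => ?_
    split_ifs with h
    · exact one_mul _
    · rw [not_not.1 h, hρ]

lemma edgeTotal_comp (ρ : (comp H (K2 n)).V → (comp H (K2 n)).V → ℝ) :
    (comp H (K2 n)).edgeTotal ρ =
      ∑ e, ∑ i, (ρ (old n (H.src e)) (mid e i) + ρ (mid e i) (old n (H.tgt e))) := by
  rw [edgeTotal, sum_comp_edges]
  simp only [src_half_false, src_half_true, tgt_half_false, tgt_half_true]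

/-- Every scale contributes at most half of `n` times the total length of the edges, up to an error
that telescopes: it is paid by the growth of the total length from one scale to the next. -/
lemma total_demands_le (k : ℕ) {ρ : ((K2 n).power k).V → ((K2 n).power k).V → ℝ}
    (hρ : IsK2Semimetric n ρ) :
    (demands n k).total ρ ≤ (n * k / 2 + n) * ((K2 n).power k).edgeTotal ρ := by
  induction k with
  | zero =>
    have h0 : (demands n 0).total ρ = 0 := Fintype.sum_empty (ι := Empty) _
    rw [h0]
    exact mul_nonneg (by positivity) (Finset.sum_nonneg fun e _ => hρ.nonneg _ _)
  | succ k ih =>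
    set H := (K2 n).power k
    change IsK2Semimetric (X := (comp H (K2 n)).V) n ρ at hρ
    have ih' := ih (hρ.comap (old n))
    have h1 : ((demands n k).refine n).total ρ = _ := total_refine (demands n k) hρ.self
    have h2 := edgeTotal_comp (H := H) (n := n) ρ
    have h3 : ∑ e, ∑ i, ∑ j, ρ (mid e i) (mid e j) +
        n ^ 2 / 2 * H.edgeTotal (fun u v => ρ (old n u) (old n v)) ≤
        n * (comp H (K2 n)).edgeTotal ρ := by
      rw [h2, edgeTotal, Finset.mul_sum, Finset.mul_sum, ← Finset.sum_add_distrib]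
      exact Finset.sum_le_sum fun e _ => hρ.sum_le _ _ _
    have h4 : n * H.edgeTotal (fun u v => ρ (old n u) (old n v)) ≤
        (comp H (K2 n)).edgeTotal ρ := by
      rw [h2, edgeTotal, Finset.mul_sum]
      refine Finset.sum_le_sum fun e _ => ?_
      calc (n : ℝ) * ρ (old n (H.src e)) (old n (H.tgt e))
          = ∑ _i : Fin n, ρ (old n (H.src e)) (old n (H.tgt e)) := by simp
        _ ≤ _ := Finset.sum_le_sum fun i _ => hρ.triangle _ _ _
    change ((demands n k).refine n).total ρ ≤
      (n * (k + 1 : ℕ) / 2 + n) * (comp H (K2 n)).edgeTotal ρ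
    rw [h1]
    push_cast
    have hn : (0 : ℝ) ≤ n := n.cast_nonneg
    have h5 := mul_le_mul_of_nonneg_left ih' hn
    have h6 := mul_le_mul_of_nonneg_left h4 (show (0 : ℝ) ≤ n * (k + 1) / 2 by positivity)
    nlinarith

/-- Every demand pair has a Lipschitz function that separates it as far as possible; together they
witness that the demands, weighted with their distances, add up to `k n ^ k (n - 1)`. -/
lemma exists_edgeLipschitz_demands (hn : 0 < n) (k : ℕ) :
    ∃ g : (demands n k).ι → ((K2 n).power k).V → ℝ,
      (∀ c, ((K2 n).power k).EdgeLipschitz (g c)) ∧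
      ∑ c, (demands n k).demand c * (g c ((demands n k).source c) - g c ((demands n k).target c)) =
        k * n ^ k * (n - 1) := by
  classical
  induction k with
  | zero => exact ⟨fun c => c.elim, fun c => c.elim, by
      rw [Nat.cast_zero, zero_mul, zero_mul]; exact Fintype.sum_empty (ι := Empty) _⟩
  | succ k ih =>
    obtain ⟨g, hg, hs⟩ := ih
    set H := (K2 n).power k
    -- for a new pair: the length of the new edges at one of its vertices, the negative of it at the
    -- other, and zero elsewhere; this is Lipschitz since no two middle vertices are adjacent
    let m (q : H.E × {p : Fin n × Fin n // p.1 ≠ p.2}) (e : H.E) (j : Fin n) : ℝ :=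
      if e = q.1 then ((if j = q.2.1.1 then (1 / 2 ^ (k + 1) : ℝ) else 0) -
        if j = q.2.1.2 then (1 / 2 ^ (k + 1) : ℝ) else 0) else 0
    have hm : ∀ q e j, |m q e j| ≤ 1 / 2 ^ (k + 1) := by
      intro q e j
      have h0 : (0 : ℝ) < 1 / 2 ^ (k + 1) := by positivity
      have hq := q.2.2
      simp only [m]
      split_ifs with h1 h2 h3
      · exact absurd (h2.symm.trans h3) hq
      · rw [sub_zero, abs_of_pos h0]
      · rw [zero_sub, abs_neg, abs_of_pos h0]
      · simp
      · simp
    let g' : ((demands n k).refine n).ι → (comp H (K2 n)).V → ℝ :=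
      Sum.elim (fun c => extend (g c) fun e _ => (g c (H.src e) + g c (H.tgt e)) / 2)
        fun q => extend 0 (m q)
    refine ⟨g', ?_, ?_⟩
    · rintro (c | q)
      · exact (hg c).extend hn
      · change (comp H (K2 n)).EdgeLipschitz (extend 0 (m q))
        refine edge_cases fun e i b => ?_
        have hl : ((comp H (K2 n)).len (half e i b) : ℝ) = 1 / 2 ^ (k + 1) := by
          have := len_power hn (k + 1) (half e i b)
          exact (congrArg NNReal.toReal this).trans (by push_cast; rfl)
        rw [hl]
        cases b
        · rw [src_half_false, tgt_half_false, extend_old, extend_mid, Pi.zero_apply, zero_sub,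
            abs_neg]
          exact hm q e i
        · rw [src_half_true, tgt_half_true, extend_old, extend_mid, Pi.zero_apply, sub_zero]
          exact hm q e i
    · refine (sum_refine (demands n k) _).trans ?_
      have h1 : ∀ c, ((demands n k).refine n).demand (Sum.inl c) *
          (g' (Sum.inl c) (((demands n k).refine n).source (Sum.inl c)) -
            g' (Sum.inl c) (((demands n k).refine n).target (Sum.inl c))) =
          n * ((demands n k).demand c *
            (g c ((demands n k).source c) - g c ((demands n k).target c))) :=
        fun c => mul_assoc _ _ _
      have h2 : ∀ (e : H.E) (p : {p : Fin n × Fin n // p.1 ≠ p.2}),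
          ((demands n k).refine n).demand (Sum.inr (e, p)) *
          (g' (Sum.inr (e, p)) (((demands n k).refine n).source (Sum.inr (e, p))) -
            g' (Sum.inr (e, p)) (((demands n k).refine n).target (Sum.inr (e, p)))) =
          1 / 2 ^ k := by
        intro e p
        change 1 * (m (e, p) e p.1.1 - m (e, p) e p.1.2) = _
        have hp := p.2
        simp only [m, if_true, if_neg hp, if_neg (Ne.symm hp)]
        rw [pow_succ]
        field_simp
        norm_num
      have h3 : ∑ _p : {p : Fin n × Fin n // p.1 ≠ p.2}, (1 / 2 ^ k : ℝ) =
          1 * (n * (n - 1) * (1 / 2 ^ k)) := by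
        refine (sum_ne_pairs fun _ _ => (1 / 2 ^ k : ℝ)).trans ?_
        have : ∀ i : Fin n, (∑ j : Fin n, if i ≠ j then (1 / 2 ^ k : ℝ) else 0) =
            (n - 1) * (1 / 2 ^ k) := by
          intro i
          have hij : ∀ j : Fin n, (if i ≠ j then (1 / 2 ^ k : ℝ) else 0) =
              1 / 2 ^ k - if i = j then (1 / 2 ^ k : ℝ) else 0 := by
            intro j; split_ifs <;> simp_all
          simp only [hij, Finset.sum_sub_distrib, Finset.sum_ite_eq, Finset.mem_univ, if_true,
            Finset.sum_const, Finset.card_univ, Fintype.card_fin, nsmul_eq_mul]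
          ring
        simp only [this, Finset.sum_const, Finset.card_univ, Fintype.card_fin, nsmul_eq_mul]
        ring
      refine (congrArg₂ (· + ·) (Finset.sum_congr rfl fun c _ => h1 c)
        (Finset.sum_congr rfl fun e _ => Finset.sum_congr rfl fun p _ => h2 e p)).trans ?_
      rw [← Finset.mul_sum, hs, h3, ← Finset.sum_mul, card_edges_power, mul_pow]
      push_cast
      field_simp
      ring

/-! ### A flow that loads all edges equally -/

open Classical in
/-- The net amount that the flow `f` sends out of the vertex `v`. -/
noncomputable def divergence (G : STGraph) (f : G.E → ℝ) (v : G.V) : ℝ :=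
  (∑ e, if G.src e = v then f e else 0) - ∑ e, if G.tgt e = v then f e else 0

lemma divergence_old (f : (comp H (K2 n)).E → ℝ) (v : H.V) :
    (comp H (K2 n)).divergence f (old n v) = (open Classical in
      (∑ e, if H.src e = v then ∑ i, f (half e i false) else 0) -
        ∑ e, if H.tgt e = v then ∑ i, f (half e i true) else 0) := by
  rw [divergence, sum_comp_edges, sum_comp_edges]
  simp only [src_half_true, tgt_half_false, mid_ne_old, if_false, add_zero, zero_add]
  congr 1
  · refine Finset.sum_congr rfl fun e _ => ?_
    split_ifs with h
    · exact Finset.sum_congr rfl fun i _ => if_pos (by rw [src_half_false, h])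
    · exact Finset.sum_eq_zero fun i _ => if_neg (by rwa [src_half_false, old_inj])
  · refine Finset.sum_congr rfl fun e _ => ?_
    split_ifs with h
    · exact Finset.sum_congr rfl fun i _ => if_pos (by rw [tgt_half_true, h])
    · exact Finset.sum_eq_zero fun i _ => if_neg (by rwa [tgt_half_true, old_inj])

lemma divergence_mid (f : (comp H (K2 n)).E → ℝ) (e : H.E) (i : Fin n) :
    (comp H (K2 n)).divergence f (mid e i) = f (half e i true) - f (half e i false) := by
  classical
  rw [divergence, sum_comp_edges, sum_comp_edges]
  simp only [src_half_false, src_half_true, tgt_half_false, tgt_half_true, old_ne_mid, mid_inj,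
    if_false, add_zero, zero_add]
  have key : ∀ F : H.E → Fin n → ℝ,
      (∑ e', ∑ i', if e' = e ∧ i' = i then F e' i' else 0) = F e i := by
    intro F
    rw [Finset.sum_eq_single e (fun e' _ he' => by simp [he']) (by simp),
      Finset.sum_eq_single i (fun i' _ hi' => by simp [hi']) (by simp)]
    simp
  exact congrArg₂ (· - ·) (by simpa using key fun e i => f (half e i true))
    (by simpa using key fun e i => f (half e i false))

/-- A flow on the edges of `H` (multiplied by `n`), spread evenly over the `n` paths of every copy
of `K_{2,n}`. -/
noncomputable def spreadFlow (n : ℕ) (f : H.E → ℝ) : (comp H (K2 n)).E → ℝ := fun a => f a.1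

open Classical in
/-- The unit flow from the middle vertex `i` to the middle vertex `j` over `e`, one half of it
through each terminal. -/
noncomputable def pairFlow (e : H.E) (i j : Fin n) : (comp H (K2 n)).E → ℝ := fun a =>
  if a.1 = e then (if a.2.2 then 1 / 2 else -1 / 2) *
    ((if a.2.1 = i then 1 else 0) - (if a.2.1 = j then 1 else 0)) else 0

lemma spreadFlow_half (f : H.E → ℝ) (e : H.E) (i : Fin n) (b : Bool) :
    spreadFlow n f (half e i b) = f e := rfl

open Classical in
lemma pairFlow_half (e e' : H.E) (i j i' : Fin n) (b : Bool) :
    pairFlow e i j (half e' i' b) = if e' = e then (if b then 1 / 2 else -1 / 2) *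
      ((if i' = i then 1 else 0) - (if i' = j then 1 else 0)) else 0 := rfl

open Classical in
/-- The given demands can all be shipped at once, with load at most `L` on every edge. -/
def DemandFamily.HasFlow {G : STGraph} (D : DemandFamily G) (L : ℝ) : Prop :=
  ∃ F : D.ι → G.E → ℝ,
    (∀ c v, G.divergence (F c) v =
      D.demand c * ((if v = D.source c then 1 else 0) - (if v = D.target c then 1 else 0))) ∧
    ∀ e, ∑ c, |F c e| ≤ L

lemma divergence_spreadFlow_old (f : H.E → ℝ) (v : H.V) :
    (comp H (K2 n)).divergence (spreadFlow n f) (old n v) = n * H.divergence f v := by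
  classical
  rw [divergence_old, divergence, mul_sub, Finset.mul_sum, Finset.mul_sum]
  congr 1 <;> refine Finset.sum_congr rfl fun e _ => ?_ <;> split_ifs <;> simp [spreadFlow_half]

lemma divergence_pairFlow_old (e : H.E) (i j : Fin n) (v : H.V) :
    (comp H (K2 n)).divergence (pairFlow e i j) (old n v) = 0 := by
  classical
  have h : ∀ e' b, ∑ i', pairFlow e i j (half e' i' b) = 0 := by
    intro e' b
    simp only [pairFlow_half]
    by_cases he : e' = e
    · simp only [he, if_true, ← Finset.mul_sum, Finset.sum_sub_distrib, Finset.sum_ite_eq',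
        Finset.mem_univ, sub_self, mul_zero]
    · simp only [he, if_false, Finset.sum_const_zero]
  rw [divergence_old]
  simp [h]

lemma sum_abs_pairFlow_le (a : (comp H (K2 n)).E) :
    ∑ e : H.E, ∑ p : {p : Fin n × Fin n // p.1 ≠ p.2}, |pairFlow e p.1.1 p.1.2 a| ≤ n - 1 := by
  classical
  rw [Finset.sum_eq_single a.1 (fun e _ he => by simp [pairFlow, he.symm]) (by simp)]
  obtain ⟨e, i, b⟩ := a
  have hp : ∀ p : {p : Fin n × Fin n // p.1 ≠ p.2},
      |pairFlow e p.1.1 p.1.2 (half e i b)| ≤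
        (if i = p.1.1 then 1 / 2 else 0) + if i = p.1.2 then 1 / 2 else 0 := by
    intro p
    have := p.2
    simp only [pairFlow_half, if_true, abs_mul]
    have hb : |(if b = true then (1 / 2 : ℝ) else -1 / 2)| = 1 / 2 := by
      split_ifs <;> norm_num [abs_div]
    rw [hb]
    split_ifs <;> norm_num
  refine (Finset.sum_le_sum fun p _ => hp p).trans ?_
  refine (sum_ne_pairs fun i₁ i₂ =>
    ((if i = i₁ then 1 / 2 else 0) + if i = i₂ then 1 / 2 else 0 : ℝ)).le.trans ?_
  have hij : ∀ i₁ i₂ : Fin n, (if i₁ ≠ i₂ then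
      ((if i = i₁ then 1 / 2 else 0) + if i = i₂ then 1 / 2 else 0 : ℝ) else 0) =
      ((if i = i₁ then 1 / 2 else 0) + if i = i₂ then 1 / 2 else 0) -
        if i₁ = i₂ then (if i = i₁ then 1 else 0) else 0 := by
    intro i₁ i₂
    by_cases h : i₁ = i₂
    · subst h
      by_cases hi : i = i₁ <;> simp only [hi, ne_eq, not_true_eq_false, if_true, if_false] <;>
        norm_num
    · simp only [h, ne_eq, not_false_eq_true, if_true, if_false, sub_zero]
  have h2 : (n : ℝ) * 2⁻¹ + n * 2⁻¹ = n := by ring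
  simp only [hij]
  simp [Finset.sum_add_distrib, h2]

lemma DemandFamily.HasFlow.refine {D : DemandFamily H} {L : ℝ} (h : D.HasFlow L) :
    (D.refine n).HasFlow (L + (n - 1)) := by
  classical
  obtain ⟨F, hF, hL⟩ := h
  refine ⟨Sum.elim (fun c => spreadFlow n (F c)) fun q => pairFlow q.1 q.2.1.1 q.2.1.2, ?_, ?_⟩
  · rintro (c | ⟨e, p⟩)
    · refine vertex_cases (fun v => ?_) fun e i => ?_
      · change (STGraph.comp H (K2 n)).divergence (spreadFlow n (F c)) (old n v) =
          (n * D.demand c) * ((if old n v = old n (D.source c) then 1 else 0) -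
            (if old n v = old n (D.target c) then 1 else 0))
        rw [divergence_spreadFlow_old, hF]
        simp only [old_inj, mul_assoc]
      · change (STGraph.comp H (K2 n)).divergence (spreadFlow n (F c)) (mid e i) =
          (n * D.demand c) * ((if mid e i = old n (D.source c) then 1 else 0) -
            (if mid e i = old n (D.target c) then 1 else 0))
        rw [divergence_mid]
        simp [mid_ne_old, spreadFlow_half]
    · refine vertex_cases (fun v => ?_) fun e' i => ?_
      · change (STGraph.comp H (K2 n)).divergence (pairFlow e p.1.1 p.1.2) (old n v) =
          1 * ((if old n v = mid e p.1.1 then 1 else 0) - (if old n v = mid e p.1.2 then 1 else 0))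
        rw [divergence_pairFlow_old]
        simp [old_ne_mid]
      · change (STGraph.comp H (K2 n)).divergence (pairFlow e p.1.1 p.1.2) (mid e' i) =
          1 * ((if mid e' i = mid e p.1.1 then 1 else 0) -
            (if mid e' i = mid e p.1.2 then 1 else 0))
        rw [divergence_mid]
        simp only [mid_inj, pairFlow_half]
        by_cases he : e' = e
        · simp only [he, if_true, true_and, Bool.false_eq_true, if_false]
          ring
        · simp [he]
  · intro a
    rw [sum_refine]
    exact add_le_add (hL a.1) (sum_abs_pairFlow_le a)

/-- By symmetry, the pairs of each scale load all edges equally, with total load `n - 1`. -/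
lemma hasFlow_demands (n k : ℕ) : (demands n k).HasFlow (k * (n - 1)) := by
  induction k with
  | zero => exact ⟨fun c => c.elim, fun c => c.elim, fun e => by
      rw [Nat.cast_zero, zero_mul]; exact (Fintype.sum_empty (ι := Empty) _).le⟩
  | succ k ih =>
    have := ih.refine (n := n)
    rw [show ((k + 1 : ℕ) : ℝ) * (n - 1) = k * (n - 1) + (n - 1) by push_cast; ring]
    exact this

/-! ### A sparse cut -/

/-- The cut that extends `S` to the middle vertices so that every path of a copy of `K_{2,n}` is
cut at most once, and half of the middle vertices between the two sides of `S` lie on each side. -/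
def refineCut (n : ℕ) (S : Set H.V) : Set (comp H (K2 n)).V :=
  {x | extend (fun v => v ∈ S) (fun e i => (H.src e ∈ S ∧ H.tgt e ∈ S) ∨
    ((H.src e ∈ S ∨ H.tgt e ∈ S) ∧ (i : ℕ) < n / 2)) x}

lemma old_mem_refineCut {S : Set H.V} {v : H.V} : old n v ∈ refineCut n S ↔ v ∈ S := Iff.rfl

lemma mid_mem_refineCut {S : Set H.V} {e : H.E} {i : Fin n} :
    mid e i ∈ refineCut n S ↔ (H.src e ∈ S ∧ H.tgt e ∈ S) ∨
      ((H.src e ∈ S ∨ H.tgt e ∈ S) ∧ (i : ℕ) < n / 2) := Iff.rfl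

open Classical in
lemma cutDist_eq_ite {G : STGraph} (S : Set G.V) (u v : G.V) :
    FlowInstance.cutDist S u v = if (u ∈ S ↔ v ∈ S) then 0 else 1 := by
  by_cases hu : u ∈ S <;> by_cases hv : v ∈ S <;> simp [FlowInstance.cutDist, hu, hv]

lemma edgeTotal_refineCut (S : Set H.V) :
    (comp H (K2 n)).edgeTotal (FlowInstance.cutDist (refineCut n S)) =
      n * H.edgeTotal (FlowInstance.cutDist S) := by
  rw [edgeTotal_comp, edgeTotal, Finset.mul_sum]
  refine Finset.sum_congr rfl fun e _ => ?_
  have : ∀ i : Fin n, FlowInstance.cutDist (refineCut n S) (old n (H.src e)) (mid e i) +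
      FlowInstance.cutDist (refineCut n S) (mid e i) (old n (H.tgt e)) =
      FlowInstance.cutDist S (H.src e) (H.tgt e) := by
    intro i
    rw [cutDist_eq_ite, cutDist_eq_ite, cutDist_eq_ite, old_mem_refineCut, old_mem_refineCut,
      mid_mem_refineCut]
    by_cases h1 : H.src e ∈ S <;> by_cases h2 : H.tgt e ∈ S <;> by_cases h3 : (i : ℕ) < n / 2 <;>
      simp [h1, h2, h3]
  simp [this]

/-- Half of the middle vertices on each side separate at least half of the pairs. -/
lemma sum_cutDist_mid_ge (S : Set H.V) (e : H.E) :
    n * (n - 1) / 2 * FlowInstance.cutDist S (H.src e) (H.tgt e) ≤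
      ∑ i : Fin n, ∑ j : Fin n, FlowInstance.cutDist (refineCut n S) (mid e i) (mid e j) := by
  classical
  by_cases h : H.src e ∈ S ↔ H.tgt e ∈ S
  · rw [cutDist_eq_ite S, if_pos h, mul_zero]
    exact Finset.sum_nonneg fun i _ => Finset.sum_nonneg fun j _ => abs_nonneg _
  rw [cutDist_eq_ite S, if_neg h, mul_one]
  have hc : (∑ i : Fin n, if (i : ℕ) < n / 2 then (1 : ℝ) else 0) = (n / 2 : ℕ) := by
    rw [Finset.sum_boole, Fin.card_filter_val_lt, min_eq_right (Nat.div_le_self _ _)]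
  have hij : ∀ i j : Fin n, FlowInstance.cutDist (refineCut n S) (mid e i) (mid e j) =
      (if (i : ℕ) < n / 2 then (1 : ℝ) else 0) + (if (j : ℕ) < n / 2 then (1 : ℝ) else 0) -
        2 * ((if (i : ℕ) < n / 2 then (1 : ℝ) else 0) *
          (if (j : ℕ) < n / 2 then (1 : ℝ) else 0)) := by
    intro i j
    have hi : ∀ i : Fin n, mid e i ∈ refineCut n S ↔ (i : ℕ) < n / 2 := by
      intro i
      rw [mid_mem_refineCut]
      tauto
    rw [cutDist_eq_ite, hi, hi]
    by_cases h1 : (i : ℕ) < n / 2 <;> by_cases h2 : (j : ℕ) < n / 2 <;> simp [h1, h2]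
    norm_num
  simp only [hij, Finset.sum_sub_distrib, Finset.sum_add_distrib, ← Finset.mul_sum,
    ← Finset.sum_mul, hc, Finset.sum_const, Finset.card_univ, Fintype.card_fin, nsmul_eq_mul]
  obtain ⟨m, rfl | rfl⟩ := n.even_or_odd'
  · rw [Nat.mul_div_cancel_left m two_pos]
    push_cast
    nlinarith [m.cast_nonneg (α := ℝ)]
  · rw [show (2 * m + 1) / 2 = m by omega]
    push_cast
    nlinarith [m.cast_nonneg (α := ℝ)]

lemma exists_sparse_cut (n k : ℕ) : ∃ S : Set ((K2 n).power k).V,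
    ((K2 n).power k).edgeTotal (FlowInstance.cutDist S) = n ^ k ∧
    k * n ^ k * (n - 1) / 2 ≤ (demands n k).total (FlowInstance.cutDist S) := by
  induction k with
  | zero =>
    refine ⟨{singleEdge.s}, ?_, ?_⟩
    · refine (Fintype.sum_unique (ι := Unit) _).trans ?_
      exact (cutDist_eq_ite (G := singleEdge) {singleEdge.s} singleEdge.s singleEdge.t).trans
        ((if_neg fun h => singleEdge.s_ne_t (h.1 rfl).symm).trans (pow_zero _).symm)
    · rw [Nat.cast_zero, zero_mul, zero_mul, zero_div]
      exact (Fintype.sum_empty (ι := Empty) _).ge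
  | succ k ih =>
    obtain ⟨S, h1, h2⟩ := ih
    have h3 := edgeTotal_refineCut (n := n) S
    have h4 := total_refine (demands n k) (n := n)
      (ρ := FlowInstance.cutDist (refineCut n S)) fun x => by simp [FlowInstance.cutDist]
    refine ⟨refineCut n S, ?_, ?_⟩
    · exact h3.trans (by rw [h1, pow_succ, mul_comm])
    · refine le_of_le_of_eq ?_ h4.symm
      have h5 := Finset.sum_le_sum fun e (_ : e ∈ Finset.univ) => sum_cutDist_mid_ge (n := n) S e
      rw [← Finset.mul_sum, ← edgeTotal, h1] at h5
      have h6 := mul_le_mul_of_nonneg_left h2 (n.cast_nonneg (α := ℝ))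
      refine le_trans (le_of_eq ?_) (add_le_add h6 h5)
      push_cast
      ring

/-! ### The flow/cut gap -/

section Gap

variable {G : STGraph} (D : DemandFamily G)

/-- The flow instance with unit capacities and the given demands. -/
noncomputable def DemandFamily.toInstance (h : Nonempty D.ι)
    (hne : ∀ c, D.source c ≠ D.target c) (hD : ∀ c, 1 ≤ D.demand c) : FlowInstance G where
  cap := fun _ => 1
  m := Fintype.card D.ι
  m_pos := Fintype.card_pos
  source := fun i => D.source ((Fintype.equivFin D.ι).symm i)
  target := fun i => D.target ((Fintype.equivFin D.ι).symm i)
  source_ne_target := fun _ => hne _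
  demand := fun i => D.demand ((Fintype.equivFin D.ι).symm i)
  one_le_demand := fun _ => hD _

variable (h : Nonempty D.ι) (hne : ∀ c, D.source c ≠ D.target c) (hD : ∀ c, 1 ≤ D.demand c)

lemma cutCap_toInstance (S : Set G.V) :
    (D.toInstance h hne hD).cutCap S = G.edgeTotal (FlowInstance.cutDist S) := by
  simp [FlowInstance.cutCap, edgeTotal, DemandFamily.toInstance]

lemma cutDemand_toInstance (S : Set G.V) :
    (D.toInstance h hne hD).cutDemand S = D.total (FlowInstance.cutDist S) :=
  (Fintype.equivFin D.ι).symm.sum_comp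
    fun c => D.demand c * FlowInstance.cutDist S (D.source c) (D.target c)

lemma sum_mul_divergence (f : G.E → ℝ) (g : G.V → ℝ) :
    ∑ v, g v * G.divergence f v = ∑ e, f e * (g (G.src e) - g (G.tgt e)) := by
  classical
  have key : ∀ φ : G.E → G.V, ∑ v, g v * (∑ e, if φ e = v then f e else 0) =
      ∑ e, f e * g (φ e) := by
    intro φ
    simp only [Finset.mul_sum]
    rw [Finset.sum_comm]
    refine Finset.sum_congr rfl fun e _ => ?_
    rw [Finset.sum_eq_single (φ e) (fun v _ hv => by simp [hv.symm]) (by simp)]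
    simp [mul_comm]
  simp only [mul_sub, Finset.sum_sub_distrib, ← key, divergence]

/-- Weak duality: a concurrent flow needs at least the distances that its demands travel. -/
lemma mul_sum_le_of_isConcurrentFlow {r : ℝ}
    {f : Fin (D.toInstance h hne hD).m → G.E → ℝ}
    (hf : (D.toInstance h hne hD).IsConcurrentFlow r f) {g : D.ι → G.V → ℝ}
    (hg : ∀ c, G.EdgeLipschitz (g c)) :
    r * ∑ c, D.demand c * (g c (D.source c) - g c (D.target c)) ≤ ∑ e, (G.len e : ℝ) := by
  classical
  let I := D.toInstance h hne hD
  let g' : Fin I.m → G.V → ℝ := fun i => g ((Fintype.equivFin D.ι).symm i)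
  have h1 : ∀ i, r * (I.demand i * (g' i (I.source i) - g' i (I.target i))) =
      ∑ e, f i e * (g' i (G.src e) - g' i (G.tgt e)) := by
    intro i
    rw [← sum_mul_divergence]
    have h2 : ∀ v, G.divergence (f i) v = _ := hf.1 i
    simp only [h2]
    have h3 : ∀ v, g' i v * (r * I.demand i *
        ((if v = I.source i then 1 else 0) - (if v = I.target i then 1 else 0))) =
        (if v = I.source i then r * I.demand i * g' i v else 0) -
          (if v = I.target i then r * I.demand i * g' i v else 0) := by
      intro v; split_ifs <;> ring
    rw [Finset.sum_congr rfl fun v _ => (by convert h3 v)]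
    rw [Finset.sum_sub_distrib, Finset.sum_ite_eq', Finset.sum_ite_eq']
    simp only [Finset.mem_univ, if_true]
    ring
  have h4 : ∑ c, D.demand c * (g c (D.source c) - g c (D.target c)) =
      ∑ i, I.demand i * (g' i (I.source i) - g' i (I.target i)) :=
    ((Fintype.equivFin D.ι).symm.sum_comp
      fun c => D.demand c * (g c (D.source c) - g c (D.target c))).symm
  rw [h4, Finset.mul_sum, Finset.sum_congr rfl fun i _ => h1 i, Finset.sum_comm]
  refine Finset.sum_le_sum fun e _ => ?_
  calc ∑ i, f i e * (g' i (G.src e) - g' i (G.tgt e)) ≤ ∑ i, |f i e| * G.len e := by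
        refine Finset.sum_le_sum fun i _ => (le_abs_self _).trans ?_
        rw [abs_mul]
        exact mul_le_mul_of_nonneg_left (hg _ e) (abs_nonneg _)
    _ = (∑ i, |f i e|) * G.len e := (Finset.sum_mul ..).symm
    _ ≤ 1 * G.len e := mul_le_mul_of_nonneg_right
        ((hf.2 e).trans_eq (by simp [DemandFamily.toInstance])) (NNReal.coe_nonneg _)
    _ = G.len e := one_mul _

lemma le_maxFlow_of_hasFlow {L : ℝ} (hL : 0 < L) (hF : D.HasFlow L) :
    ENNReal.ofReal L⁻¹ ≤ (D.toInstance h hne hD).maxFlow := by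
  obtain ⟨F, hF, hFL⟩ := hF
  have hr : 0 ≤ L⁻¹ := inv_nonneg.2 hL.le
  refine le_iSup₂_of_le L⁻¹ ⟨hr, fun i e => L⁻¹ * F ((Fintype.equivFin D.ι).symm i) e,
    fun i v => ?_, fun e => ?_⟩ le_rfl
  · have hi := congrArg (L⁻¹ * ·) (hF ((Fintype.equivFin D.ι).symm i) v)
    simp only [divergence, mul_sub, Finset.mul_sum, mul_ite, mul_zero, mul_one] at hi ⊢
    exact hi
  · have : ∀ c, |L⁻¹ * F c e| = L⁻¹ * |F c e| := fun c => by rw [abs_mul, abs_of_nonneg hr]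
    refine ((Fintype.equivFin D.ι).symm.sum_comp fun c => |L⁻¹ * F c e|).le.trans ?_
    simp only [this, ← Finset.mul_sum]
    refine (mul_le_mul_of_nonneg_left (hFL e) hr).trans ?_
    rw [inv_mul_cancel₀ hL.ne']
    simp [DemandFamily.toInstance]

end Gap

lemma demands_source_ne_target (n k : ℕ) (c : (demands n k).ι) :
    (demands n k).source c ≠ (demands n k).target c := by
  induction k with
  | zero => exact c.elim
  | succ k ih =>
    rcases c with c | ⟨e, p⟩
    · exact fun h => ih c (old_inj.1 h)
    · exact fun h => p.2 (mid_inj.1 h).2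

lemma one_le_demands (hn : 0 < n) (k : ℕ) (c : (demands n k).ι) : 1 ≤ (demands n k).demand c := by
  induction k with
  | zero => exact c.elim
  | succ k ih =>
    rcases c with c | ⟨e, p⟩
    · exact one_le_mul_of_one_le_of_one_le (by exact_mod_cast hn) (ih c)
    · exact le_refl (1 : ℝ)

lemma nonempty_demands (hn : 2 ≤ n) {k : ℕ} (hk : 0 < k) : Nonempty (demands n k).ι := by
  obtain ⟨g, -, hs⟩ := exists_edgeLipschitz_demands (by omega : 0 < n) k
  by_contra h
  rw [not_nonempty_iff] at h
  rw [Fintype.sum_empty] at hs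
  have h1 : (0 : ℝ) < k := by exact_mod_cast hk
  have h2 : (2 : ℝ) ≤ n := by exact_mod_cast hn
  have : (0 : ℝ) < k * n ^ k * (n - 1) := by
    have : (0 : ℝ) < n - 1 := by linarith
    positivity
  exact this.ne hs

lemma sum_len_power (hn : 0 < n) (k : ℕ) :
    ∑ e, (((K2 n).power k).len e : ℝ) = n ^ k := by
  have : ∀ e, (((K2 n).power k).len e : ℝ) = 1 * (1 / 2 ^ k) := by
    intro e; rw [len_power hn]; push_cast; rw [one_mul]
  rw [Finset.sum_congr rfl fun e _ => this e, ← Finset.sum_mul, card_edges_power, mul_pow]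
  field_simp

/-- The flow instance of the demands on all scales has gap at least
`k (n - 1) / (n k / 2 + n)`, and at most `2`. -/
lemma exists_gap_bounds (hn : 2 ≤ n) {k : ℕ} (hk : 0 < k) :
    ∃ I : FlowInstance ((K2 n).power k),
      ENNReal.ofReal (k * (n - 1) / (n * k / 2 + n)) ≤ I.gap ∧ I.gap ≤ 2 := by
  have hn0 : 0 < n := by omega
  have hk' : (0 : ℝ) < k := by exact_mod_cast hk
  have hn1 : (0 : ℝ) < n - 1 := by
    have : (2 : ℝ) ≤ n := by exact_mod_cast hn
    linarith
  have hn' : (0 : ℝ) < n := by exact_mod_cast hn0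
  have hL : 0 < (k : ℝ) * (n - 1) := mul_pos hk' hn1
  have hnk : (0 : ℝ) < n ^ k := by positivity
  have hne := demands_source_ne_target n k
  have hD := one_le_demands hn0 k
  have hN := nonempty_demands hn hk
  set I := (demands n k).toInstance hN hne hD
  have hsparse_ge : ENNReal.ofReal (1 / (n * k / 2 + n)) ≤ I.sparsestCut := by
    refine le_iInf₂ fun S hS => ENNReal.ofReal_le_ofReal ?_
    have := total_demands_le k ((isK2Semimetric_abs n).comap (S.indicator fun _ => (1 : ℝ)))
    rw [div_le_div_iff₀ (by positivity) hS, one_mul, mul_comm, cutDemand_toInstance,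
      cutCap_toInstance]
    exact this
  have hsparse_le : I.sparsestCut ≤ ENNReal.ofReal (2 / (k * (n - 1))) := by
    obtain ⟨S, h1, h2⟩ := exists_sparse_cut n k
    have hpos : 0 < k * n ^ k * ((n : ℝ) - 1) / 2 := by positivity
    refine iInf₂_le_of_le S ?_ (ENNReal.ofReal_le_ofReal ?_)
    · rw [cutDemand_toInstance]
      exact hpos.trans_le h2
    · rw [cutDemand_toInstance, cutCap_toInstance, h1]
      refine (div_le_div_of_nonneg_left hnk.le hpos h2).trans_eq ?_
      field_simp
  have hflow_ge : ENNReal.ofReal (1 / (k * (n - 1))) ≤ I.maxFlow := by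
    rw [one_div]
    exact le_maxFlow_of_hasFlow _ hN hne hD hL (hasFlow_demands n k)
  have hflow_le : I.maxFlow ≤ ENNReal.ofReal (1 / (k * (n - 1))) := by
    refine iSup₂_le fun r hr => ENNReal.ofReal_le_ofReal ?_
    obtain ⟨-, f, hf⟩ := hr
    obtain ⟨g, hg, hs⟩ := exists_edgeLipschitz_demands hn0 k
    have := mul_sum_le_of_isConcurrentFlow _ hN hne hD hf hg
    rw [hs, sum_len_power hn0] at this
    rw [le_div_iff₀ hL]
    refine le_of_mul_le_mul_right ?_ hnk
    linarith
  refine ⟨I, ?_, ?_⟩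
  · refine le_trans (le_of_eq ?_) (ENNReal.div_le_div hsparse_ge hflow_le)
    rw [← ENNReal.ofReal_div_of_pos (by positivity)]
    congr 1
    field_simp
  · refine (ENNReal.div_le_div hsparse_le hflow_ge).trans (le_of_eq ?_)
    rw [← ENNReal.ofReal_div_of_pos (by positivity)]
    rw [show (2 / (k * ((n : ℝ) - 1))) / (1 / (k * ((n : ℝ) - 1))) = 2 by field_simp]
    simp

/-! ### The distortion of embeddings into `L₁` -/

lemma c1_le_of_isometry {X Y : Type*} {d : X → X → ℝ≥0} {d' : Y → Y → ℝ≥0} {φ : X → Y}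
    (hφ : Function.Injective φ) (hd : ∀ x y, d' (φ x) (φ y) = d x y) : c1 d ≤ c1 d' := by
  refine le_iInf fun Ω => le_iInf fun mΩ => le_iInf fun μ => le_iInf fun f => le_iInf fun hf => ?_
  refine iInf_le_of_le Ω <| iInf_le_of_le mΩ <| iInf_le_of_le μ <| iInf_le_of_le (f ∘ φ) <|
    iInf_le_of_le (hf.comp hφ) <| mul_le_mul' ?_ ?_
  · refine iSup_le fun x => iSup_le fun y => iSup_le fun hxy => ?_
    rw [← hd]
    exact le_iSup_of_le (φ x) <| le_iSup_of_le (φ y) <| le_iSup_of_le (hφ.ne hxy) le_rfl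
  · refine iSup_le fun x => iSup_le fun y => iSup_le fun hxy => ?_
    rw [← hd]
    exact le_iSup_of_le (φ x) <| le_iSup_of_le (φ y) <| le_iSup_of_le (hφ.ne hxy) le_rfl

lemma c1_power_mono (hn : 0 < n) : Monotone fun k : ℕ => c1 ((K2 n).power k).dist :=
  monotone_nat_of_le_succ fun k => c1_le_of_isometry (φ := old (H := (K2 n).power k) n)
    (fun _ _ h => old_inj.1 h) (dist_old hn (isConn_power hn k))

/-- The constants of an embedding of finite distortion, as real numbers. -/
lemma distortion_eq_top_or {X Y : Type*} [NormedAddCommGroup Y] {d : X → X → ℝ≥0} {f : X → Y}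
    (hf : Function.Injective f) {x₀ y₀ : X} (h₀ : x₀ ≠ y₀) (hd₀ : d x₀ y₀ ≠ 0) :
    distortion d f = ⊤ ∨ ∃ A B : ℝ≥0, distortion d f = A * B ∧
      ∀ x y, x ≠ y → ‖f x - f y‖ ≤ A * d x y ∧ d x y ≤ B * ‖f x - f y‖ := by
  rw [distortion]
  set a : ℝ≥0∞ := ⨆ (x : X) (y : X) (_ : x ≠ y), edist (f x) (f y) / (d x y : ℝ≥0∞)
  set b : ℝ≥0∞ := ⨆ (x : X) (y : X) (_ : x ≠ y), (d x y : ℝ≥0∞) / edist (f x) (f y)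
  have hax : ∀ x y, x ≠ y → edist (f x) (f y) / (d x y : ℝ≥0∞) ≤ a := fun x y h =>
    le_iSup_of_le x <| le_iSup_of_le y <| le_iSup_of_le h le_rfl
  have hbx : ∀ x y, x ≠ y → (d x y : ℝ≥0∞) / edist (f x) (f y) ≤ b := fun x y h =>
    le_iSup_of_le x <| le_iSup_of_le y <| le_iSup_of_le h le_rfl
  have he : ∀ x y, x ≠ y → edist (f x) (f y) ≠ 0 := fun x y h => by
    exact fun h0 => h (hf (edist_eq_zero.1 h0))
  have ha0 : a ≠ 0 := fun h => ENNReal.div_ne_zero.2 ⟨he _ _ h₀, ENNReal.coe_ne_top⟩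
    (le_zero_iff.1 (h ▸ hax _ _ h₀))
  have hb0 : b ≠ 0 := fun h => ENNReal.div_ne_zero.2
    ⟨ENNReal.coe_ne_zero.2 hd₀, edist_ne_top _ _⟩ (le_zero_iff.1 (h ▸ hbx _ _ h₀))
  rcases eq_or_ne a ⊤ with hat | hat
  · left; rw [hat, ENNReal.top_mul hb0]
  rcases eq_or_ne b ⊤ with hbt | hbt
  · left; rw [hbt, ENNReal.mul_top ha0]
  right
  clear_value a b
  lift a to ℝ≥0 using hat
  lift b to ℝ≥0 using hbt
  refine ⟨a, b, rfl, fun x y hxy => ⟨?_, ?_⟩⟩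
  · have := hax x y hxy
    rw [ENNReal.div_le_iff_le_mul (Or.inr ENNReal.coe_ne_top) (Or.inl ENNReal.coe_ne_top),
      edist_nndist] at this
    rw [← dist_eq_norm, ← coe_nndist]
    exact_mod_cast this
  · have := hbx x y hxy
    rw [ENNReal.div_le_iff_le_mul (Or.inl (he x y hxy)) (Or.inl (edist_ne_top _ _)),
      edist_nndist] at this
    rw [← dist_eq_norm, ← coe_nndist]
    exact_mod_cast this

lemma dist_power_s_t_ne_zero (hn : 0 < n) (k : ℕ) :
    ((K2 n).power k).dist ((K2 n).power k).s ((K2 n).power k).t ≠ 0 := by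
  have h : ((K2 n).power k).dist ((K2 n).power k).s ((K2 n).power k).t =
      singleEdge.dist singleEdge.s singleEdge.t := by
    induction k with
    | zero => rfl
    | succ k ih => exact (dist_old hn (isConn_power hn k) _ _).trans ih
  have hg : singleEdge.EdgeLipschitz fun b : Bool => if b then 1 else 0 := by
    intro e
    simp [singleEdge]
  have := EdgeLipschitz.le_dist (G := singleEdge) (isConn_power hn 0) hg singleEdge.s singleEdge.t
  rw [h]
  intro h0
  rw [h0] at this
  change |(0 : ℝ) - 1| ≤ _ at this
  norm_num at this

lemma le_c1_power (hn : 0 < n) (k : ℕ) :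
    ENNReal.ofReal (k * (n - 1) / (n * k / 2 + n)) ≤ c1 ((K2 n).power k).dist := by
  set G := (K2 n).power k
  refine le_iInf fun Ω => le_iInf fun mΩ => le_iInf fun μ => le_iInf fun f => le_iInf fun hf => ?_
  rcases distortion_eq_top_or (d := G.dist) hf G.s_ne_t (dist_power_s_t_ne_zero hn k) with
    h | ⟨A, B, h, hAB⟩
  · rw [h]; exact le_top
  have hAB' : ∀ x y, ‖f x - f y‖ ≤ A * G.dist x y ∧ G.dist x y ≤ B * ‖f x - f y‖ := by
    intro x y
    rcases eq_or_ne x y with rfl | hxy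
    · simp [dist_self]
    · exact hAB x y hxy
  have hn' : (0 : ℝ) < n := by exact_mod_cast hn
  have hnk : (0 : ℝ) < n ^ k := by positivity
  obtain ⟨g, hg, hs⟩ := exists_edgeLipschitz_demands hn k
  have h1 : k * n ^ k * ((n : ℝ) - 1) ≤ B * (demands n k).total fun x y => ‖f x - f y‖ := by
    rw [← hs, DemandFamily.total, Finset.mul_sum]
    refine Finset.sum_le_sum fun c _ => ?_
    rw [mul_left_comm]
    refine mul_le_mul_of_nonneg_left ?_ (zero_le_one.trans (one_le_demands hn k c))
    exact ((le_abs_self _).trans ((hg c).le_dist (isConn_power hn k) _ _)).trans (hAB' _ _).2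
  have h2 := total_demands_le k ((isK2Semimetric_L1 n μ).comap f)
  have h3 : G.edgeTotal (fun x y => ‖f x - f y‖) ≤ A * n ^ k := by
    rw [← sum_len_power hn, Finset.mul_sum]
    refine Finset.sum_le_sum fun e _ => (hAB' _ _).1.trans ?_
    exact mul_le_mul_of_nonneg_left (by exact_mod_cast dist_src_tgt_le e) A.coe_nonneg
  have h4 : k * n ^ k * ((n : ℝ) - 1) ≤ B * ((n * k / 2 + n) * (A * n ^ k)) :=
    h1.trans (mul_le_mul_of_nonneg_left
      (h2.trans (mul_le_mul_of_nonneg_left h3 (by positivity))) B.coe_nonneg)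
  rw [h, ← ENNReal.coe_mul, ← ENNReal.ofReal_coe_nnreal]
  refine ENNReal.ofReal_le_ofReal ?_
  rw [div_le_iff₀ (by positivity)]
  refine le_of_mul_le_mul_right ?_ hnk
  push_cast
  linarith

/-! ### Series-parallel structure -/

lemma IsSPBetween.symm {G : STGraph} {A : Set G.E} {u v : G.V} (h : G.IsSPBetween A u v) :
    G.IsSPBetween A v u := by
  induction h with
  | edge e huv he => exact .edge e huv.symm he.symm
  | series _ _ hAB ihA ihB =>
    rw [Set.union_comm]
    exact .series ihB ihA (by rwa [Set.inter_comm])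
  | parallel _ _ hd hAB ihA ihB =>
    exact .parallel ihA ihB hd (by rw [hAB, Set.pair_comm])

lemma IsSPBetween.src_ne_tgt {G : STGraph} {A : Set G.E} {u v : G.V} (h : G.IsSPBetween A u v)
    {e : G.E} (he : e ∈ A) : G.src e ≠ G.tgt e := by
  induction h with
  | edge e' huv he' =>
    obtain rfl := Set.mem_singleton_iff.1 he
    rcases he' with ⟨rfl, rfl⟩ | ⟨rfl, rfl⟩
    · exact huv
    · exact huv.symm
  | series _ _ _ ihA ihB => exact he.elim ihA ihB
  | parallel _ _ _ _ ihA ihB => exact he.elim ihA ihB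

lemma mem_ends {G : STGraph} {A : Set G.E} {v : G.V} :
    v ∈ G.ends A ↔ ∃ e ∈ A, G.src e = v ∨ G.tgt e = v := by
  simp only [ends, Set.mem_union, Set.mem_image]
  grind

/-- The edges of the copies of `K_{2,n}` that replace the edges in `A`. -/
def lifts (n : ℕ) (A : Set H.E) : Set (comp H (K2 n)).E := {a | a.1 ∈ A}

lemma old_mem_ends_lifts (hn : 0 < n) {A : Set H.E} {v : H.V} :
    old n v ∈ (comp H (K2 n)).ends (lifts n A) ↔ v ∈ H.ends A := by
  simp only [mem_ends]
  constructor
  · rintro ⟨⟨e, i, b⟩, he, h⟩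
    change (comp H (K2 n)).src (half e i b) = _ ∨ (comp H (K2 n)).tgt (half e i b) = _ at h
    refine ⟨e, he, ?_⟩
    cases b
    · rw [src_half_false, tgt_half_false, old_inj] at h
      exact Or.inl (h.resolve_right (mid_ne_old v e i))
    · rw [src_half_true, tgt_half_true, old_inj] at h
      exact Or.inr (h.resolve_left (mid_ne_old v e i))
  · rintro ⟨e, he, h | h⟩
    · exact ⟨half e ⟨0, hn⟩ false, he, Or.inl (by rw [src_half_false, h])⟩
    · exact ⟨half e ⟨0, hn⟩ true, he, Or.inr (by rw [tgt_half_true, h])⟩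

lemma mid_mem_ends_lifts {A : Set H.E} {e : H.E} {i : Fin n} :
    mid e i ∈ (comp H (K2 n)).ends (lifts n A) ↔ e ∈ A := by
  simp only [mem_ends]
  constructor
  · rintro ⟨⟨e', i', b⟩, he, h⟩
    change (comp H (K2 n)).src (half e' i' b) = _ ∨ (comp H (K2 n)).tgt (half e' i' b) = _ at h
    have : e' = e := by
      cases b
      · rw [src_half_false, tgt_half_false] at h
        exact (mid_inj.1 (h.resolve_left (old_ne_mid _ e i))).1
      · rw [src_half_true, tgt_half_true] at h
        exact (mid_inj.1 (h.resolve_right (old_ne_mid _ e i))).1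
    exact this ▸ he
  · exact fun he => ⟨half e i false, he, Or.inr (tgt_half_false _ _)⟩

lemma ends_lifts_inter (hn : 0 < n) {A B : Set H.E} (hd : Disjoint A B) :
    (comp H (K2 n)).ends (lifts n A) ∩ (comp H (K2 n)).ends (lifts n B) =
      old n '' (H.ends A ∩ H.ends B) := by
  ext x
  revert x
  refine vertex_cases (fun v => ?_) fun e i => ?_
  · simp only [Set.mem_inter_iff, old_mem_ends_lifts hn, Set.mem_image, old_inj, exists_eq_right]
  · simp only [Set.mem_inter_iff, mid_mem_ends_lifts, Set.mem_image, old_ne_mid, and_false,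
      exists_false, iff_false]
    exact fun h => Set.disjoint_left.1 hd h.1 h.2

/-- The paths through the middle vertices in a nonempty set, in parallel. -/
lemma isSPBetween_copy (e : H.E) (he : H.src e ≠ H.tgt e) {T : Finset (Fin n)} (hT : T.Nonempty) :
    (comp H (K2 n)).IsSPBetween {a | ∃ i ∈ T, ∃ b, a = half e i b} (old n (H.src e))
        (old n (H.tgt e)) := by
  have hends : ∀ (T : Finset (Fin n)), T.Nonempty → ∀ x, x ∈ (comp H (K2 n)).ends
      {a | ∃ i ∈ T, ∃ b, a = half e i b} ↔
      x = old n (H.src e) ∨ x = old n (H.tgt e) ∨ ∃ i ∈ T, x = mid e i := by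
    rintro T ⟨i₀, hi₀⟩ x
    rw [mem_ends]
    constructor
    · rintro ⟨_, ⟨i, hi, b, rfl⟩, h⟩
      cases b
      · rw [src_half_false, tgt_half_false] at h
        exact h.elim (fun h => Or.inl h.symm) fun h => Or.inr (Or.inr ⟨i, hi, h.symm⟩)
      · rw [src_half_true, tgt_half_true] at h
        exact h.elim (fun h => Or.inr (Or.inr ⟨i, hi, h.symm⟩)) fun h => Or.inr (Or.inl h.symm)
    · rintro (rfl | rfl | ⟨i, hi, rfl⟩)
      · exact ⟨_, ⟨i₀, hi₀, false, rfl⟩, Or.inl (src_half_false _ _)⟩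
      · exact ⟨_, ⟨i₀, hi₀, true, rfl⟩, Or.inr (tgt_half_true _ _)⟩
      · exact ⟨_, ⟨i, hi, false, rfl⟩, Or.inr (tgt_half_false _ _)⟩
  have hpath : ∀ i : Fin n, (comp H (K2 n)).IsSPBetween
      {a | ∃ j ∈ ({i} : Finset (Fin n)), ∃ b, a = half e j b} (old n (H.src e))
        (old n (H.tgt e)) := by
    intro i
    have h1 : (comp H (K2 n)).IsSPBetween {half e i false} (old n (H.src e)) (mid e i) :=
      .edge _ (old_ne_mid _ _ _) (Or.inl ⟨src_half_false _ _, tgt_half_false _ _⟩)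
    have h2 : (comp H (K2 n)).IsSPBetween {half e i true} (mid e i) (old n (H.tgt e)) :=
      .edge _ (mid_ne_old _ _ _) (Or.inl ⟨src_half_true _ _, tgt_half_true _ _⟩)
    have h12 := IsSPBetween.series h1 h2 (by
      ext x
      simp only [Set.mem_inter_iff, mem_ends, Set.mem_singleton_iff, exists_eq_left,
        src_half_false, tgt_half_false, src_half_true, tgt_half_true]
      constructor
      · rintro ⟨rfl | rfl, h | h⟩
        · exact absurd h.symm (old_ne_mid _ _ _)
        · exact absurd (old_inj.1 h.symm) he
        · rfl
        · rfl
      · rintro rfl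
        exact ⟨Or.inr rfl, Or.inl rfl⟩)
    convert h12 using 1
    ext a
    simp only [Finset.mem_singleton, exists_eq_left, Set.mem_ofPred_eq, Set.mem_union,
      Set.mem_singleton_iff, Bool.exists_bool]
  induction hT using Finset.Nonempty.cons_induction with
  | singleton i => exact hpath i
  | cons i T hi hT ih =>
    have h := IsSPBetween.parallel (hpath i) ih
      (by
        rw [Set.disjoint_left]
        rintro _ ⟨j, hj, b, rfl⟩ ⟨j', hj', b', h⟩
        obtain ⟨-, rfl, -⟩ := half_inj.1 h
        exact hi (Finset.mem_singleton.1 hj ▸ hj'))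
      (by
        ext x
        rw [Set.mem_inter_iff, hends _ (Finset.singleton_nonempty i), hends _ hT]
        simp only [Set.mem_insert_iff, Set.mem_singleton_iff, Finset.mem_singleton,
          exists_eq_left]
        constructor
        · rintro ⟨h1 | h1 | rfl, h2 | h2 | ⟨j, hj, h2⟩⟩
          · exact Or.inl h1
          · exact Or.inl h1
          · exact Or.inl h1
          · exact Or.inr h1
          · exact Or.inr h1
          · exact Or.inr h1
          · exact Or.inl h2
          · exact Or.inr h2
          · exact absurd ((mid_inj.1 h2).2 ▸ hj) hi
        · rintro (h | h)
          · exact ⟨Or.inl h, Or.inl h⟩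
          · exact ⟨Or.inr (Or.inl h), Or.inr (Or.inl h)⟩)
    convert h using 1
    ext a
    simp only [Finset.mem_cons, Set.mem_ofPred_eq, Set.mem_union, Finset.mem_singleton,
      exists_eq_left]
    grind

lemma IsSPBetween.lifts (hn : 0 < n) {A : Set H.E} {u v : H.V} (h : H.IsSPBetween A u v) :
    (comp H (K2 n)).IsSPBetween (lifts n A) (old n u) (old n v) := by
  induction h with
  | edge e huv he =>
    have hne : H.src e ≠ H.tgt e := by
      rcases he with ⟨rfl, rfl⟩ | ⟨rfl, rfl⟩
      · exact huv
      · exact huv.symm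
    have h := isSPBetween_copy (n := n) e hne (T := Finset.univ) ⟨⟨0, hn⟩, Finset.mem_univ _⟩
    have hset : {a | ∃ i ∈ (Finset.univ : Finset (Fin n)), ∃ b, a = half e i b} =
        STGraph.lifts n {e} := by
      ext a
      revert a
      refine edge_cases fun e' i b => ?_
      constructor
      · rintro ⟨i, -, b, h⟩
        exact (half_inj.1 h).1
      · rintro rfl
        exact ⟨i, Finset.mem_univ _, b, rfl⟩
    rw [hset] at h
    rcases he with ⟨rfl, rfl⟩ | ⟨rfl, rfl⟩
    · exact h
    · exact h.symm
  | @series A B u w v hA hB hAB ihA ihB =>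
    have hd : Disjoint A B := by
      rw [Set.disjoint_left]
      intro e heA heB
      have h1 : H.src e ∈ H.ends A ∩ H.ends B :=
        ⟨mem_ends.2 ⟨e, heA, Or.inl rfl⟩, mem_ends.2 ⟨e, heB, Or.inl rfl⟩⟩
      have h2 : H.tgt e ∈ H.ends A ∩ H.ends B :=
        ⟨mem_ends.2 ⟨e, heA, Or.inr rfl⟩, mem_ends.2 ⟨e, heB, Or.inr rfl⟩⟩
      rw [hAB] at h1 h2
      exact hA.src_ne_tgt heA (h1.trans h2.symm)
    exact .series ihA ihB
      ((ends_lifts_inter hn hd).trans (by rw [hAB, Set.image_singleton]))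
  | parallel hA hB hd hAB ihA ihB =>
    exact .parallel ihA ihB
      (Set.disjoint_left.2 fun a h1 h2 => Set.disjoint_left.1 hd h1 h2)
      ((ends_lifts_inter hn hd).trans (by rw [hAB, Set.image_pair]))

lemma IsSeriesParallel.comp (hn : 0 < n) (h : H.IsSeriesParallel) :
    (comp H (K2 n)).IsSeriesParallel := by
  have hl : STGraph.lifts n (Set.univ : Set H.E) = Set.univ :=
    Set.eq_univ_of_forall fun _ => trivial
  refine ⟨hl ▸ h.1.lifts hn, Set.eq_univ_of_forall ?_⟩
  rw [← hl]
  refine vertex_cases (fun v => ?_) fun e i => mid_mem_ends_lifts.2 trivial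
  rw [old_mem_ends_lifts hn, h.2]
  trivial

lemma isSeriesParallel_power (hn : 0 < n) (k : ℕ) : ((K2 n).power k).IsSeriesParallel := by
  induction k with
  | zero =>
    constructor
    · have h := IsSPBetween.edge (G := singleEdge) () singleEdge.s_ne_t (Or.inl ⟨rfl, rfl⟩)
      have h1 : Set.singleton () = (Set.univ : Set singleEdge.E) :=
        Set.eq_univ_of_forall fun _ => rfl
      exact (congrArg (fun A => singleEdge.IsSPBetween A _ _) h1).mp h
    · refine Set.eq_univ_of_forall fun v => mem_ends.2 ⟨(), trivial, ?_⟩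
      cases v
      · exact Or.inl rfl
      · exact Or.inr rfl
  | succ k ih => exact ih.comp hn

/-! ### Planar drawings -/

/-- A drawing of the graph at integer points: `x` is a level function that grows by one along every
edge, and two edges over the same levels, drawn as segments, are disjoint except perhaps for
common end points, one of them lying above the other. -/
structure LevelDrawing (G : STGraph) where
  x : G.V → ℤ
  y : G.V → ℤ
  inj : ∀ u v, x u = x v → y u = y v → u = v
  x_tgt : ∀ e, x (G.tgt e) = x (G.src e) + 1
  above : ∀ e e', e ≠ e' → x (G.src e) = x (G.src e') →
    (y (G.src e) ≤ y (G.src e') ∧ y (G.tgt e) ≤ y (G.tgt e') ∧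
      y (G.src e) + y (G.tgt e) < y (G.src e') + y (G.tgt e')) ∨
    (y (G.src e') ≤ y (G.src e) ∧ y (G.tgt e') ≤ y (G.tgt e) ∧
      y (G.src e') + y (G.tgt e') < y (G.src e) + y (G.tgt e))

/-- The middle vertices of a copy are placed close to the midpoint of the replaced segment. -/
def LevelDrawing.comp (hn : 0 < n) (D : LevelDrawing H) : LevelDrawing (comp H (K2 n)) where
  x := extend (fun v => 2 * D.x v) fun e _ => 2 * D.x (H.src e) + 1
  y := extend (fun v => 2 * n * D.y v) fun e i => n * (D.y (H.src e) + D.y (H.tgt e)) + i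
  inj := by
    refine vertex_cases (fun u => ?_) fun e i => ?_ <;>
      refine vertex_cases (fun v => ?_) fun e' i' => ?_ <;>
      simp only [extend_old, extend_mid] <;> intro h1 h2
    · have hn' : (2 * n : ℤ) ≠ 0 := by positivity
      exact old_inj.2 (D.inj u v (by omega) (mul_left_cancel₀ hn' h2))
    · omega
    · omega
    · have hi : (i : ℤ) < n := by exact_mod_cast i.2
      have hi' : (i' : ℤ) < n := by exact_mod_cast i'.2
      by_cases he : e = e'
      · subst he
        exact mid_inj.2 ⟨rfl, Fin.ext (by omega)⟩
      · exfalso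
        rcases D.above e e' he (by omega) with ⟨-, -, h⟩ | ⟨-, -, h⟩
        · nlinarith
        · nlinarith
  x_tgt := by
    refine edge_cases fun e i b => ?_
    have := D.x_tgt e
    cases b
    · rw [src_half_false, tgt_half_false, extend_old, extend_mid]
    · rw [src_half_true, tgt_half_true, extend_old, extend_mid]
      omega
  above := by
    refine edge_cases fun e i b => edge_cases fun e' i' b' => ?_
    have hi : (i : ℤ) < n := by exact_mod_cast i.2
    have hi' : (i' : ℤ) < n := by exact_mod_cast i'.2
    have hn' : (0 : ℤ) < n := by exact_mod_cast hn
    intro hne hx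
    have hb : b = b' := by
      cases b <;> cases b' <;>
        simp only [src_half_false, src_half_true, extend_old, extend_mid] at hx <;>
        first | rfl | omega
    subst hb
    have hx' : D.x (H.src e) = D.x (H.src e') := by
      cases b <;> simp only [src_half_false, src_half_true, extend_old, extend_mid] at hx <;> omega
    by_cases he : e = e'
    · subst he
      have hii : (i : ℕ) ≠ i' := fun h => hne (half_inj.2 ⟨rfl, Fin.ext h, rfl⟩)
      cases b <;> simp only [src_half_false, tgt_half_false, src_half_true, tgt_half_true,
        extend_old, extend_mid] <;> omega
    · rcases D.above e e' he hx' with ⟨h1, h2, h3⟩ | ⟨h1, h2, h3⟩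
      · left
        have h1' := mul_le_mul_of_nonneg_left h1 (show (0 : ℤ) ≤ 2 * n by positivity)
        have h2' := mul_le_mul_of_nonneg_left h2 (show (0 : ℤ) ≤ 2 * n by positivity)
        cases b <;> simp only [src_half_false, tgt_half_false, src_half_true, tgt_half_true,
          extend_old, extend_mid] <;> refine ⟨?_, ?_, ?_⟩ <;> nlinarith
      · right
        have h1' := mul_le_mul_of_nonneg_left h1 (show (0 : ℤ) ≤ 2 * n by positivity)
        have h2' := mul_le_mul_of_nonneg_left h2 (show (0 : ℤ) ≤ 2 * n by positivity)
        cases b <;> simp only [src_half_false, tgt_half_false, src_half_true, tgt_half_true,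
          extend_old, extend_mid] <;> refine ⟨?_, ?_, ?_⟩ <;> nlinarith

lemma nonempty_levelDrawing_power (hn : 0 < n) (k : ℕ) :
    Nonempty (LevelDrawing ((K2 n).power k)) := by
  induction k with
  | zero => exact ⟨{
      x := fun b : Bool => if b then 1 else 0
      y := fun _ => 0
      inj := fun u v h _ => by
        cases u <;> cases v <;> first | rfl | exact absurd h (by decide)
      x_tgt := fun _ => rfl
      above := fun e e' h => absurd rfl h }⟩
  | succ k ih => exact ih.map fun D => D.comp hn

lemma LevelDrawing.isPlanar {G : STGraph} (D : LevelDrawing G) : G.IsPlanar := by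
  have hint : ∀ (a b : ℤ) (x x' : ℝ), x ∈ Set.Ioo (0 : ℝ) 1 → x' ∈ Set.Ico (0 : ℝ) 1 →
      a + x = b + x' → a = b ∧ x = x' := by
    intro a b x x' hx hx' h
    have hab : a = b := by
      have h1 : (a : ℝ) < b + 1 := by linarith [hx.1, hx'.2]
      have h2 : (b : ℝ) < a + 1 := by linarith [hx.2, hx'.1]
      have h1' : a < b + 1 := by exact_mod_cast h1
      have h2' : b < a + 1 := by exact_mod_cast h2
      omega
    subst hab
    exact ⟨rfl, by linarith⟩
  refine ⟨fun v => (D.x v, D.y v), fun e x => (D.x (G.src e) + x,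
    (1 - x) * D.y (G.src e) + x * D.y (G.tgt e)), ?_, ?_, ?_, ?_⟩
  · intro u v h
    simp only [Prod.mk.injEq, Int.cast_inj] at h
    exact D.inj u v h.1 h.2
  · intro e
    refine ⟨by fun_prop, by simp, ?_⟩
    simp [D.x_tgt]
  · intro e x hx v h
    have h1 := congrArg Prod.fst h
    have := (hint _ (D.x v) x 0 hx ⟨le_rfl, one_pos⟩ (by simpa using h1)).2
    exact hx.1.ne' this
  · intro e e' x hx x' hx' h
    have h1 := congrArg Prod.fst h
    have h2 := congrArg Prod.snd h
    obtain ⟨h3, rfl⟩ := hint _ _ x x' hx ⟨hx'.1.le, hx'.2⟩ h1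
    refine ⟨?_, rfl⟩
    by_contra hne
    simp only at h2
    have key : ∀ a b a' b' : ℤ, a ≤ a' → b ≤ b' → a + b < a' + b' →
        (1 - x) * a + x * b < (1 - x) * a' + x * b' := by
      intro a b a' b' ha hb hab
      have ha' : (a : ℝ) ≤ a' := by exact_mod_cast ha
      have hb' : (b : ℝ) ≤ b' := by exact_mod_cast hb
      have h0 := hx.1
      have h1 : 0 < 1 - x := by linarith [hx.2]
      rcases ha.lt_or_eq with hlt | rfl
      · have hlt' : (a : ℝ) < a' := by exact_mod_cast hlt
        exact add_lt_add_of_lt_of_le (mul_lt_mul_of_pos_left hlt' h1)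
          (mul_le_mul_of_nonneg_left hb' h0.le)
      · have hlt' : (b : ℝ) < b' := by exact_mod_cast (by omega : b < b')
        exact add_lt_add_of_le_of_lt le_rfl (mul_lt_mul_of_pos_left hlt' h0)
    rcases D.above e e' hne h3 with ⟨ha, hb, hab⟩ | ⟨ha, hb, hab⟩
    · exact (key _ _ _ _ ha hb hab).ne h2
    · exact (key _ _ _ _ ha hb hab).ne' h2

end STGraph

/-! ### The limits -/

lemma tendsto_gap_bound {n : ℕ} (hn : 0 < n) :
    Tendsto (fun k : ℕ => ENNReal.ofReal (k * (n - 1) / (n * k / 2 + n))) atTop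
      (𝓝 (ENNReal.ofReal (2 - 2 / (n : ℝ)))) := by
  refine ENNReal.tendsto_ofReal ?_
  have hn' : (n : ℝ) ≠ 0 := by positivity
  have h := (tendsto_natCast_div_add_atTop (2 : ℝ)).const_mul (2 - 2 / (n : ℝ))
  rw [mul_one] at h
  refine h.congr fun k => ?_
  have hk : (k : ℝ) + 2 ≠ 0 := by positivity
  have hk' : (n : ℝ) * k / 2 + n ≠ 0 := by positivity
  field_simp

lemma tendsto_gap_bound_diagonal :
    Tendsto (fun n : ℕ => ENNReal.ofReal (n * (n - 1) / (n * n / 2 + n))) atTop (𝓝 2) := by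
  rw [show (2 : ℝ≥0∞) = ENNReal.ofReal 2 by simp]
  refine ENNReal.tendsto_ofReal ?_
  have h1 := (tendsto_natCast_div_add_atTop (2 : ℝ)).const_mul (2 : ℝ)
  have h2 : Tendsto (fun n : ℕ => 1 - 1 / (n : ℝ)) atTop (𝓝 (1 - 0)) :=
    tendsto_const_nhds.sub tendsto_one_div_atTop_nhds_zero_nat
  have h3 := h1.mul h2
  rw [mul_one, sub_zero, mul_one] at h3
  refine h3.congr' ?_
  filter_upwards [eventually_gt_atTop 0] with n hn
  have hn' : (0 : ℝ) < n := by exact_mod_cast hn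
  field_simp

theorem theorem4p3 :
    (∀ n : ℕ, 2 ≤ n →
      (∃ L : ℝ≥0∞,
        Tendsto (fun k : ℕ => c1 ((STGraph.K2 n).power k).dist) atTop (𝓝 L) ∧
        ENNReal.ofReal (2 - 2 / (n : ℝ)) ≤ L) ∧
      (∀ k : ℕ, ((STGraph.K2 n).power k).IsSeriesParallel ∧ ((STGraph.K2 n).power k).IsPlanar) ∧
      ENNReal.ofReal (2 - 2 / (n : ℝ)) ≤
        liminf (fun k : ℕ => ((STGraph.K2 n).power k).flowCutGap) atTop) ∧
    (∃ (k : ℕ → ℕ) (I : ∀ n : ℕ, STGraph.FlowInstance ((STGraph.K2 n).power (k n))),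
      Tendsto (fun n : ℕ => (I n).gap) atTop (𝓝 2)) := by
  refine ⟨fun n hn => ⟨?_, ?_, ?_⟩, ?_⟩
  · have hn0 : 0 < n := by omega
    have hlim := tendsto_atTop_iSup (STGraph.c1_power_mono hn0)
    exact ⟨_, hlim, le_of_tendsto_of_tendsto' (tendsto_gap_bound hn0) hlim
      (STGraph.le_c1_power hn0)⟩
  · intro k
    obtain ⟨D⟩ := STGraph.nonempty_levelDrawing_power (by omega : 0 < n) k
    exact ⟨STGraph.isSeriesParallel_power (by omega) k, D.isPlanar⟩
  · rw [← (tendsto_gap_bound (by omega : 0 < n)).liminf_eq]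
    refine liminf_le_liminf ?_
    filter_upwards [eventually_gt_atTop 0] with k hk
    obtain ⟨I, hI, -⟩ := STGraph.exists_gap_bounds hn hk
    exact hI.trans (le_iSup (fun I : STGraph.FlowInstance _ => I.gap) I)
  · have hex : ∀ n : ℕ, ∃ (k : ℕ) (I : STGraph.FlowInstance ((STGraph.K2 n).power k)), 2 ≤ n →
        ENNReal.ofReal (n * (n - 1) / (n * n / 2 + n)) ≤ I.gap ∧ I.gap ≤ 2 := by
      intro n
      by_cases hn : 2 ≤ n
      · obtain ⟨I, hI⟩ := STGraph.exists_gap_bounds hn (by omega : 0 < n)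
        exact ⟨n, I, fun _ => hI⟩
      · -- for `n < 2` any instance will do
        exact ⟨0, ⟨fun _ => 1, 1, one_pos, fun _ => STGraph.singleEdge.s,
          fun _ => STGraph.singleEdge.t, fun _ => STGraph.singleEdge.s_ne_t, fun _ => 1,
          fun _ => le_rfl⟩, fun h => absurd h hn⟩
    choose k I hI using hex
    refine ⟨k, I, tendsto_of_tendsto_of_tendsto_of_le_of_le' tendsto_gap_bound_diagonal
      tendsto_const_nhds ?_ ?_⟩
    · filter_upwards [eventually_ge_atTop 2] with n hn using (hI n hn).1
    · filter_upwards [eventually_ge_atTop 2] with n hn using (hI n hn).2
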